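/- Let $f\colon[0,1)\to[0,\infty)$ satisfy, for some $\sigma_{\mathrm c}\in(0,\infty)$: (f1) $f\in C^2([0,1))$ and $f^{-1}(0)=\{0\}$; (f2) $\lim_{s\to1^-}(1-s)f(s)=\sigma_{\mathrm c}$; (f3) $\frac{d}{ds}\bigl[(1-s)f(s)\bigr]>0$ for all $s\in(0,1)$; (f4) $\frac{d}{ds}\bigl[\frac{(1-s)f'(s)}{f(s)}\bigr]<0$ for all $s\in(0,1)$; (f5) $\lim_{s\to1^-}\frac{1}{(1-s)^3}\frac{d}{ds}\bigl[(1-s)f(s)\bigr]=+\infty$; (f6) $s\mapsto\sqrt s\,f(1-\sqrt s)$ is convex on $(0,1]$. For $s\ge0$ let $\mathcal U_s$ be the set of pairs $(\alpha,\beta)\in H^1_{\mathrm{loc}}(\mathbb R)\times H^1_{\mathrm{loc}}(\mathbb R)$ (continuous representatives) with $\alpha'\in L^1(\mathbb R)$, $\bigl|\int_{\mathbb R}\alpha'\,dt\bigr|=s$, $0\le\beta\le1$ and $\lim_{|t|\to\infty}\beta(t)=1$, and define $$g(s)=\inf_{(\alpha,\beta)\in\mathcal U_s}\mathcal G(\alpha,\beta),\qquad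 \mathcal G(\alpha,\beta)=\int_{\mathbb R}\Bigl(f^2(\beta)|\alpha'|^2+\frac{(1-\beta)^2}{4}+|\beta'|^2\Bigr)dt,$$ with the conventions $f(1)=+\infty$ and $\infty\cdot0=0$. Put $s_{\mathrm{frac}}=\sup\{s\ge0: g(s)<1\}\in[0,\infty]$. A pair $(\alpha,\beta)\in\mathcal U_s$ with $\mathcal G(\alpha,\beta)=g(s)$ is called optimal for $g(s)$. Then $g$ is finite and of class $C^1$ on $[0,\infty)$. For every $0\le s<s_{\mathrm{frac}}$ an optimal pair for $g(s)$ exists, and the minimum $\bar m_s=\min_{\mathbb R}\beta_s$ is attained and is the same for all optimal pairs $(\alpha_s,\beta_s)$; for $s\ge s_{\mathrm{frac}}$ set $\beta_s(t)=1-e^{-|t|/2}$, so that $\bar m_s=\min_{\mathbb R}\beta_s=0$. One has $\bar m_0=1$, $\bar m_s\in[0,1)$ for $s>0$, and $$g'(s)=(1-\bar m_s)f(\bar m_s)\qquad\text{for all }s\ge0,$$ where $g'(0)$ is the right derivative, and for $s=0$ the right-hand side is understood as $\lim_{t\to1^-}(1-t)f(t)=\sigma_{\mathrm c}$. -/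

import Mathlib

open MeasureTheory Set Filter Topology
open scoped ENNReal ContDiff

noncomputable section

namespace CohesiveFracture

/-- Assumptions on the degradation function `f : [0,1) → [0,∞)` (only the values of `f` on
`[0,1)` matter); `σ` is the limit of `(1-s) f(s)` as `s → 1⁻`. -/
structure Assumptions (f : ℝ → ℝ) (σ : ℝ) : Prop where
  contDiffOn : ContDiffOn ℝ 2 f (Ico 0 1)
  nonneg : ∀ s ∈ Ico (0 : ℝ) 1, 0 ≤ f s
  eq_zero_iff : ∀ s ∈ Ico (0 : ℝ) 1, f s = 0 ↔ s = 0
  limit_pos : 0 < σ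
  limit : Tendsto (fun s => (1 - s) * f s) (𝓝[<] 1) (𝓝 σ)
  deriv_pos : ∀ s ∈ Ioo (0 : ℝ) 1, 0 < deriv (fun t => (1 - t) * f t) s
  deriv_neg : ∀ s ∈ Ioo (0 : ℝ) 1, deriv (fun t => (1 - t) * deriv f t / f t) s < 0
  deriv_limit : Tendsto (fun s => 1 / (1 - s) ^ 3 * deriv (fun t => (1 - t) * f t) s)
    (𝓝[<] 1) atTop
  convex : ConvexOn ℝ (Ioc 0 1) (fun s => √s * f (1 - √s))

/-- `v` is a weak (distributional) derivative of `u` on `ℝ`. -/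
def HasWeakDeriv (u v : ℝ → ℝ) : Prop :=
  LocallyIntegrable u ∧ LocallyIntegrable v ∧
    ∀ φ : ℝ → ℝ, ContDiff ℝ ∞ φ → HasCompactSupport φ →
      ∫ t, u t * deriv φ t = - ∫ t, v t * φ t

open Classical in
/-- The weak derivative of `u` (unique up to null sets), and `0` if there is none. -/
def weakDeriv (u : ℝ → ℝ) : ℝ → ℝ :=
  if h : ∃ v, HasWeakDeriv u v then h.choose else 0

/-- `u` is (the continuous representative of) a function in `H¹_loc(ℝ)`. By continuity `u` is
automatically locally square integrable. -/
def MemH1Loc (u : ℝ → ℝ) : Prop :=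
  Continuous u ∧ HasWeakDeriv u (weakDeriv u) ∧
    ∀ K : Set ℝ, IsCompact K → MemLp (weakDeriv u) 2 (volume.restrict K)

/-- The class `U_s` of admissible pairs `(α, β)` for the opening `s`. -/
def admissible (s : ℝ) : Set ((ℝ → ℝ) × (ℝ → ℝ)) :=
  {p | MemH1Loc p.1 ∧ MemH1Loc p.2 ∧ Integrable (weakDeriv p.1) ∧
    |∫ t, weakDeriv p.1 t| = s ∧ (∀ t, 0 ≤ p.2 t ∧ p.2 t ≤ 1) ∧
    Tendsto p.2 (cocompact ℝ) (𝓝 1)}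

/-- The coefficient `f²(b)` for `b ∈ [0,1]`, extended by its limit `+∞` at `b = 1`. -/
def coeff (f : ℝ → ℝ) (b : ℝ) : ℝ≥0∞ :=
  if b < 1 then ENNReal.ofReal (f b ^ 2) else ⊤

/-- The energy `G(α, β) = ∫ f²(β)|α'|² + (1-β)²/4 + |β'|²`, with value in `[0,∞]`. In the
first term `∞ · 0 = 0`, as usual. -/
def energy (f : ℝ → ℝ) (p : (ℝ → ℝ) × (ℝ → ℝ)) : ℝ≥0∞ :=
  ∫⁻ t, (coeff f (p.2 t) * ENNReal.ofReal (weakDeriv p.1 t ^ 2)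
    + ENNReal.ofReal ((1 - p.2 t) ^ 2 / 4) + ENNReal.ofReal (weakDeriv p.2 t ^ 2))

/-- The infimum of the energy over the admissible pairs, as an element of `[0,∞]`. -/
def infEnergy (f : ℝ → ℝ) (s : ℝ) : ℝ≥0∞ :=
  ⨅ p ∈ admissible s, energy f p

/-- The cohesive energy density `g`; it is meant for `s ≥ 0`. -/
def g (f : ℝ → ℝ) (s : ℝ) : ℝ := (infEnergy f s).toReal

/-- The threshold of complete fracture `sup {s ≥ 0 : g(s) < 1}`, possibly `+∞`. -/
def sFrac (f : ℝ → ℝ) : EReal :=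
  sSup ((fun s : ℝ => (s : EReal)) '' {s : ℝ | 0 ≤ s ∧ g f s < 1})

/-- `p = (α, β)` is an optimal pair for `g(s)`. -/
def IsOptimal (f : ℝ → ℝ) (s : ℝ) (p : (ℝ → ℝ) × (ℝ → ℝ)) : Prop :=
  p ∈ admissible s ∧ energy f p = infEnergy f s

/-- `m` is the minimum of the optimal profile `β_s`. Below the threshold, optimal pairs exist
and all of them have a second component with minimum `m`; from the threshold on, the profile
is by definition `β_s(t) = 1 - exp(-|t|/2)`. -/
def IsProfileMin (f : ℝ → ℝ) (s m : ℝ) : Prop :=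
  ((s : EReal) < sFrac f →
    (∃ p, IsOptimal f s p) ∧ ∀ p, IsOptimal f s p → IsLeast (range p.2) m) ∧
  (sFrac f ≤ (s : EReal) → IsLeast (range fun t : ℝ => 1 - Real.exp (-|t| / 2)) m)

end CohesiveFracture

end

noncomputable section

namespace CohesiveFracture

/-! Let `H(w) = √w f(1 - √w)`, i.e. `stressSq`: the stress `(1 - β) f(β)` in the variable `w = (1 -
β)²`. By (f2), (f3) and (f6), `H` is convex and decreases strictly from `σ` to `0` on `[0,1]`. For
`c ∈ [0,σ]` put `q_c = √(1 - (c/H)²)` where `H ≥ c` and `q_c = 0` elsewhere (`cofactor`), and `Φ(c)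
= ∫₀¹ q_c` (`legendre`). Everything follows from the formula `g(s) = min_c (c s + Φ(c))`.

Lower bound (`calibration`, `le_energy`): if `β` has minimum `b` and `c` is the stress at `b`,
Young's and Cauchy–Schwarz inequalities bound the energy density below by `c|α'| + q_c (1 - β)|β'|`.
The first term integrates to at least `c s`. The second is a total derivative on each side of the
minimum point, worth `Φ(c)/2` there.

Upper bound (`exists_pair`, `opening_eq`): equality in the calibration is an autonomous equation for
`y = (1 - β)²`. Its solution has opening `∫ c/(H² q_c)`, formally `-Φ'(c)`, which equals `s` exactly
when `c` minimizes. If the minimizer is `0`, the value is `Φ(0) = 1`, approached by plateau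
competitors.

Layer cake writes `Φ(c)` as the integral over `u ∈ (0,1)` of the inverse of `H` at `c/√(1 - u²)`. As
the inverse of a decreasing convex function is convex, `Φ` is convex, and strictly so because this
inverse vanishes beyond `σ` (`strictConvexOn_legendre`). The minimizer `c(s)` is therefore unique
and continuous, and the envelope theorem (`exists_minimizer_hasDerivAt`) gives `g' = c(s)`.
Uniqueness also forces every optimal profile to have stress `c(s)` at its minimum, so `m̄_s` is well
defined and `g'(s) = (1 - m̄_s) f(m̄_s)`. -/

/-! ### Weak derivatives on the line -/

lemma exists_uniform_support {φ : ℝ → ℝ} (h : HasCompactSupport φ) :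
    ∃ R : ℝ, 0 < R ∧ ∀ t, R ≤ |t| → φ t = 0 := by
  obtain ⟨R, hR, h⟩ := h.exists_pos_le_norm
  exact ⟨R, hR, fun t ht => h t (by simpa using ht)⟩

lemma integral_eq_intervalIntegral {φ : ℝ → ℝ} {R : ℝ}
    (h : ∀ t, R ≤ |t| → φ t = 0) : ∫ t, φ t = ∫ t in (-R)..R, φ t := by
  symm
  apply intervalIntegral.integral_eq_integral_of_support_subset
  intro t ht
  have : |t| < R := by
    by_contra hc
    exact ht (h t (not_lt.1 hc))
  rw [abs_lt] at this
  exact ⟨this.1, this.2.le⟩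

lemma deriv_eq_zero_of_support {φ : ℝ → ℝ} {R : ℝ}
    (h : ∀ t, R ≤ |t| → φ t = 0) : ∀ t, R + 1 ≤ |t| → deriv φ t = 0 := by
  intro t ht
  have ht1 : R < |t| := (lt_add_one R).trans_le ht
  have : φ =ᶠ[𝓝 t] fun _ => 0 := by
    have : ∀ᶠ x in 𝓝 t, R < |x| := (continuous_abs.tendsto t).eventually (lt_mem_nhds ht1)
    filter_upwards [this] with x hx using h x hx.le
  rw [this.deriv_eq]
  simp

/-- Primitives of locally integrable functions have the expected weak derivative. -/
lemma hasWeakDeriv_integral {u v : ℝ → ℝ} (hv : LocallyIntegrable v)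
    (hu : ∀ t, u t = u 0 + ∫ x in (0 : ℝ)..t, v x) : HasWeakDeriv u v := by
  have hii : ∀ a b, IntervalIntegrable v volume a b := fun a b =>
    (hv.integrableOn_isCompact isCompact_uIcc).intervalIntegrable
  have hcont : Continuous u := by
    have : u = fun t => u 0 + ∫ x in (0 : ℝ)..t, v x := funext hu
    rw [this]
    exact continuous_const.add (intervalIntegral.continuous_primitive hii 0)
  refine ⟨hcont.locallyIntegrable, hv, fun φ hφ hφs => ?_⟩
  obtain ⟨R, hR, hR0⟩ := exists_uniform_support hφs
  have hd := deriv_eq_zero_of_support hR0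
  have hR1 : 0 < R + 1 := by linarith
  rw [integral_eq_intervalIntegral (φ := fun t => u t * deriv φ t)
      (fun t ht => by simp [hd t ht]),
    integral_eq_intervalIntegral (φ := fun t => v t * φ t)
      (fun t ht => by simp [hR0 t ((lt_add_one R).le.trans ht)])]
  have hac : AbsolutelyContinuousOnInterval u (-(R + 1)) (R + 1) := by
    have h1 := (hii (-(R + 1)) (R + 1)).absolutelyContinuousOnInterval_intervalIntegral
      (c := 0) (by rw [uIcc_of_le (by linarith)]; constructor <;> linarith)
    have h2 : AbsolutelyContinuousOnInterval (fun _ : ℝ => u 0) (-(R + 1)) (R + 1) :=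
      (contDiff_const.contDiffOn).absolutelyContinuousOnInterval
    have : u = (fun _ => u 0) + fun t => ∫ x in (0 : ℝ)..t, v x := funext hu
    rw [this]
    exact h2.add h1
  have hφac : AbsolutelyContinuousOnInterval φ (-(R + 1)) (R + 1) :=
    ((hφ.of_le (by simp)).contDiffOn).absolutelyContinuousOnInterval
  rw [hac.integral_mul_deriv_eq_deriv_mul hφac, hR0 (R + 1) (by rw [abs_of_pos hR1]; linarith),
    hR0 (-(R + 1)) (by rw [abs_neg, abs_of_pos hR1]; linarith)]
  simp only [mul_zero, sub_zero, zero_sub, neg_inj]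
  apply intervalIntegral.integral_congr_ae
  filter_upwards [LocallyIntegrable.ae_hasDerivAt_integral hv] with x hx _
  have h3 := (hx 0).const_add (u 0)
  have : u = fun t => u 0 + ∫ x in (0 : ℝ)..t, v x := funext hu
  rw [this, h3.deriv]

lemma HasWeakDeriv.ae_unique {u v w : ℝ → ℝ} (hv : HasWeakDeriv u v) (hw : HasWeakDeriv u w) :
    v =ᵐ[volume] w := by
  apply ae_eq_of_integral_contDiff_smul_eq hv.2.1 hw.2.1
  intro φ hφ hφs
  have h1 := hv.2.2 φ hφ hφs
  have h2 := hw.2.2 φ hφ hφs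
  simp only [smul_eq_mul]
  simp_rw [mul_comm (φ _)]
  linarith

lemma HasWeakDeriv.weakDeriv_ae {u v : ℝ → ℝ} (hv : HasWeakDeriv u v) :
    weakDeriv u =ᵐ[volume] v := by
  have h : ∃ v, HasWeakDeriv u v := ⟨v, hv⟩
  have : HasWeakDeriv u (weakDeriv u) := by
    rw [weakDeriv, dif_pos h]
    exact h.choose_spec
  exact this.ae_unique hv

lemma HasWeakDeriv.congr_ae {u v w : ℝ → ℝ} (hv : HasWeakDeriv u v) (h : v =ᵐ[volume] w) :
    HasWeakDeriv u w := by
  refine ⟨hv.1, ?_, fun φ hφ hφs => ?_⟩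
  · intro x
    obtain ⟨s, hs, hi⟩ := hv.2.1 x
    exact ⟨s, hs, hi.congr_fun_ae (ae_restrict_of_ae h)⟩
  · rw [hv.2.2 φ hφ hφs]
    congr 1
    apply integral_congr_ae
    filter_upwards [h] with x hx
    rw [hx]

/-- A continuous function with vanishing weak derivative is constant. -/
lemma eq_const_of_integral_mul_deriv_eq_zero {z : ℝ → ℝ} (hz : Continuous z)
    (h : ∀ φ : ℝ → ℝ, ContDiff ℝ ∞ φ → HasCompactSupport φ → ∫ t, z t * deriv φ t = 0) (t : ℝ) :
    z t = z 0 := by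
  let b : ContDiffBump (0 : ℝ) := ⟨1, 2, by norm_num, by norm_num⟩
  set η : ℝ → ℝ := b.normed volume with hη
  have hηc : ContDiff ℝ ∞ η := b.contDiff_normed
  have hηs : HasCompactSupport η := b.hasCompactSupport_normed
  have hη1 : ∫ x, η x = 1 := b.integral_normed
  have hint : ∀ φ : ℝ → ℝ, Continuous φ → HasCompactSupport φ → Integrable φ := fun φ h1 h2 =>
    h1.integrable_of_hasCompactSupport h2
  set c := ∫ x, z x * η x with hc
  have key : ∀ᵐ x, z x - c = 0 := by
    apply ae_eq_zero_of_integral_contDiff_smul_eq_zero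
    · exact (hz.sub continuous_const).locallyIntegrable
    intro φ hφ hφs
    set I := ∫ x, φ x with hI
    -- Du Bois-Reymond: removing the mean of `φ` makes the primitive of `ψ` compactly supported,
    -- hence a legitimate test function.
    set ψ : ℝ → ℝ := fun x => φ x - I * η x with hψ
    have hψc : ContDiff ℝ ∞ ψ := hφ.sub (contDiff_const.mul hηc)
    have hψs : HasCompactSupport ψ := hφs.sub (hηs.mul_left)
    have hψ0 : ∫ x, ψ x = 0 := by
      rw [hψ, integral_sub (hint _ hφ.continuous hφs)
        ((hint _ hηc.continuous hηs).const_mul I), integral_const_mul, hη1]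
      simp [hI]
    obtain ⟨R, hR, hR0⟩ := exists_uniform_support hψs
    set Ψ : ℝ → ℝ := fun t => ∫ x in (-R)..t, ψ x with hΨ
    have hd : ∀ x, HasDerivAt Ψ (ψ x) x := fun x =>
      intervalIntegral.integral_hasDerivAt_right (hψc.continuous.intervalIntegrable _ _)
        (hψc.continuous.stronglyMeasurableAtFilter _ _) hψc.continuous.continuousAt
    have hdd : deriv Ψ = ψ := funext fun x => (hd x).deriv
    have hΨc : ContDiff ℝ ∞ Ψ := by
      rw [contDiff_infty_iff_deriv, hdd]
      exact ⟨fun x => (hd x).differentiableAt, hψc⟩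
    have hΨs : HasCompactSupport Ψ := by
      apply HasCompactSupport.intro (isCompact_Icc (a := -R) (b := R))
      intro x hx
      rw [mem_Icc, not_and_or, not_le, not_le] at hx
      rcases hx with hx | hx
      · apply intervalIntegral.integral_zero_ae
        filter_upwards with y hy
        rw [uIoc_of_ge hx.le] at hy
        exact hR0 y (le_abs.2 (Or.inr (by linarith [hy.2])))
      · have h2 : ∫ y in R..x, ψ y = 0 := by
          apply intervalIntegral.integral_zero_ae
          filter_upwards with y hy
          rw [uIoc_of_le hx.le] at hy
          exact hR0 y (le_abs.2 (Or.inl hy.1.le))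
        rw [hΨ]
        simp only
        rw [← intervalIntegral.integral_add_adjacent_intervals
          (hψc.continuous.intervalIntegrable (-R) R) (hψc.continuous.intervalIntegrable R x), h2,
          ← integral_eq_intervalIntegral hR0, hψ0, add_zero]
    have h0 := h Ψ hΨc hΨs
    rw [hdd] at h0
    have e1 : Integrable fun x => z x * φ x :=
      hint _ (hz.mul hφ.continuous) hφs.mul_left
    have e2 : Integrable fun x => z x * η x :=
      hint _ (hz.mul hηc.continuous) hηs.mul_left
    have e3 : (fun x => z x * ψ x) = fun x => z x * φ x - I * (z x * η x) := by
      ext x; simp only [hψ]; ring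
    rw [e3, integral_sub e1 (e2.const_mul I), integral_const_mul, ← hc] at h0
    have e4 : (fun x => φ x • (z x - c)) = fun x => z x * φ x - c * φ x := by
      ext x; simp only [smul_eq_mul]; ring
    rw [e4, integral_sub e1 ((hint _ hφ.continuous hφs).const_mul c), integral_const_mul, ← hI]
    linarith
  have h2 : (fun x => z x - c) = fun _ => 0 :=
    (hz.sub continuous_const).ae_eq_iff_eq (μ := volume) continuous_const |>.1 key
  have := congrFun h2 t
  have := congrFun h2 0
  linarith

/-- The fundamental theorem of calculus for weak derivatives. -/
lemma HasWeakDeriv.eq_integral {u v : ℝ → ℝ} (hu : Continuous u) (h : HasWeakDeriv u v) (t : ℝ) :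
    u t = u 0 + ∫ x in (0 : ℝ)..t, v x := by
  have hii : ∀ a b, IntervalIntegrable v volume a b := fun a b =>
    (h.2.1.integrableOn_isCompact isCompact_uIcc).intervalIntegrable
  set U : ℝ → ℝ := fun t => ∫ x in (0 : ℝ)..t, v x with hU
  have hUc : Continuous U := intervalIntegral.continuous_primitive hii 0
  have hUw : HasWeakDeriv U v := hasWeakDeriv_integral h.2.1 (by intro t; simp [hU])
  have key := eq_const_of_integral_mul_deriv_eq_zero (hu.sub hUc) (fun φ hφ hφs => by
    have hφ' : Continuous (deriv φ) := hφ.continuous_deriv (by simp)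
    have e : (fun t => (u - U) t * deriv φ t) = fun t => u t * deriv φ t - U t * deriv φ t := by
      ext x; simp only [Pi.sub_apply]; ring
    rw [e, integral_sub, h.2.2 φ hφ hφs, hUw.2.2 φ hφ hφs]
    · ring
    · exact (hu.mul hφ').integrable_of_hasCompactSupport hφs.deriv.mul_left
    · exact (hUc.mul hφ').integrable_of_hasCompactSupport hφs.deriv.mul_left) t
  have h0 : U 0 = 0 := by simp [hU]
  simp only [Pi.sub_apply, h0] at key
  linarith

lemma locallyIntegrable_of_bounded {v : ℝ → ℝ} (hv : Measurable v) {C : ℝ}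
    (hC : ∀ t, |v t| ≤ C) : LocallyIntegrable v :=
  (locallyIntegrable_const C).mono hv.aestronglyMeasurable
    (Eventually.of_forall fun t => by
      simpa using (hC t).trans (le_abs_self C))

/-- A primitive of a bounded function is in `H¹_loc`. -/
lemma memH1Loc_of_bounded {u v : ℝ → ℝ} (hv : Measurable v) {C : ℝ} (hC : ∀ t, |v t| ≤ C)
    (hu : ∀ t, u t = u 0 + ∫ x in (0 : ℝ)..t, v x) : MemH1Loc u ∧ weakDeriv u =ᵐ[volume] v := by
  have hl := locallyIntegrable_of_bounded hv hC
  have hw := hasWeakDeriv_integral hl hu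
  have hae := hw.weakDeriv_ae
  refine ⟨⟨?_, hw.congr_ae hae.symm, fun K hK => ?_⟩, hae⟩
  · have : u = fun t => u 0 + ∫ x in (0 : ℝ)..t, v x := funext hu
    rw [this]
    exact continuous_const.add (intervalIntegral.continuous_primitive
      (fun a b => (hl.integrableOn_isCompact isCompact_uIcc).intervalIntegrable) 0)
  · have : IsFiniteMeasure (volume.restrict K) := ⟨by
      simpa using hK.measure_lt_top⟩
    refine MemLp.ae_eq (ae_restrict_of_ae hae.symm) ?_
    exact MemLp.of_bound hv.aestronglyMeasurable C (Eventually.of_forall fun t => by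
      simpa using hC t)

/-- Chain rule, in integrated form, for a `C¹` function of a function in `H¹_loc`. -/
lemma integral_comp_mul_weakDeriv {u v F F' : ℝ → ℝ} (hu : Continuous u) (h : HasWeakDeriv u v)
    (hF : ∀ x, HasDerivAt F (F' x) x) (hF' : Continuous F') (a b : ℝ) :
    ∫ t in a..b, F' (u t) * v t = F (u b) - F (u a) := by
  have hii : ∀ a b, IntervalIntegrable v volume a b := fun a b =>
    (h.2.1.integrableOn_isCompact isCompact_uIcc).intervalIntegrable
  have hua : u = fun t => u a + ∫ x in a..t, v x := by
    ext t
    rw [h.eq_integral hu t, h.eq_integral hu a, add_assoc,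
      intervalIntegral.integral_add_adjacent_intervals (hii _ _) (hii _ _)]
  have hac : AbsolutelyContinuousOnInterval u a b := by
    have h1 := (hii a b).absolutelyContinuousOnInterval_intervalIntegral (c := a) (by simp)
    have h2 : AbsolutelyContinuousOnInterval (fun _ : ℝ => u a) a b :=
      (contDiff_const.contDiffOn).absolutelyContinuousOnInterval
    rw [hua]
    exact h2.add h1
  have hFc : ContDiff ℝ 1 F := by
    rw [contDiff_one_iff_deriv]
    have : deriv F = F' := funext fun x => (hF x).deriv
    exact ⟨fun x => (hF x).differentiableAt, this ▸ hF'⟩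
  have hFac : AbsolutelyContinuousOnInterval (F ∘ u) a b := by
    obtain ⟨R, hR⟩ := ((isCompact_uIcc (a := a) (b := b)).image hu).isBounded.subset_closedBall 0
    obtain ⟨K, hK⟩ : ∃ K, LipschitzOnWith K F (Metric.closedBall 0 R) :=
      (hFc.contDiffOn).exists_lipschitzOnWith (by decide) (convex_closedBall _ _)
        (isCompact_closedBall _ _)
    have hmaps : ∀ t ∈ uIcc a b, u t ∈ Metric.closedBall 0 R := fun t ht =>
      hR (mem_image_of_mem u ht)
    rw [absolutelyContinuousOnInterval_iff] at hac ⊢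
    intro ε hε
    -- `K + 1` rather than `K`, since the Lipschitz constant may be zero.
    obtain ⟨δ, hδ, hh⟩ := hac (ε / (K + 1)) (by positivity)
    refine ⟨δ, hδ, fun E hE hEs => ?_⟩
    have h3 := hh E hE hEs
    calc _ ≤ ∑ i ∈ Finset.range E.1, K * dist (u (E.2 i).1) (u (E.2 i).2) := by
          apply Finset.sum_le_sum
          intro i hi
          have hm := hE.1 i hi
          exact hK.dist_le_mul _ (hmaps _ hm.1) _ (hmaps _ hm.2)
      _ = K * ∑ i ∈ Finset.range E.1, dist (u (E.2 i).1) (u (E.2 i).2) := by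
          rw [Finset.mul_sum]
      _ ≤ (K + 1) * ∑ i ∈ Finset.range E.1, dist (u (E.2 i).1) (u (E.2 i).2) := by
          gcongr
          linarith
      _ < (K + 1) * (ε / (K + 1)) := by gcongr
      _ = ε := by field_simp
  have := hFac.integral_deriv_eq_sub
  simp only [Function.comp_apply] at this
  rw [← this]
  apply intervalIntegral.integral_congr_ae
  filter_upwards [LocallyIntegrable.ae_hasDerivAt_integral h.2.1] with x hx _
  have h3 : HasDerivAt u (v x) x := by
    have := (hx a).const_add (u a)
    rwa [← hua] at this
  exact ((hF (u x)).comp x h3).deriv.symm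

/-! ### The stress in the variable `w = (1 - b)²` and its inverse -/

/-- The function `b ↦ (1 - b) f(b)`, extended by its limit `σ` at `b = 1`. -/
def stress (f : ℝ → ℝ) (σ b : ℝ) : ℝ := if b < 1 then (1 - b) * f b else σ

/-- The function `stress` in the variable `w = (1 - b)²`, extended by constants to `ℝ`. -/
def stressSq (f : ℝ → ℝ) (σ w : ℝ) : ℝ := stress f σ (1 - √(min w 1))

variable {f : ℝ → ℝ} {σ : ℝ}

lemma stress_zero (hf : Assumptions f σ) : stress f σ 0 = 0 := by
  simp [stress, (hf.eq_zero_iff 0 (by simp)).2 rfl]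

lemma stress_one : stress f σ 1 = σ := by simp [stress]

lemma continuousOn_stress (hf : Assumptions f σ) : ContinuousOn (stress f σ) (Icc 0 1) := by
  intro b hb
  rcases lt_or_eq_of_le hb.2 with hb1 | rfl
  · have h1 : ContinuousWithinAt (fun b => (1 - b) * f b) (Icc 0 1) b := by
      have hc : Continuous fun b : ℝ => 1 - b := by fun_prop
      have := hc.continuousOn.mul hf.contDiffOn.continuousOn b ⟨hb.1, hb1⟩
      refine this.mono_of_mem_nhdsWithin ?_
      rw [mem_nhdsWithin]
      exact ⟨Iio 1, isOpen_Iio, hb1, fun x hx => ⟨hx.2.1, hx.1⟩⟩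
    refine h1.congr_of_eventuallyEq ?_ (by simp [stress, hb1])
    filter_upwards [mem_nhdsWithin_of_mem_nhds (Iio_mem_nhds hb1)] with x hx
    simp [stress, mem_Iio.1 hx]
  · rw [ContinuousWithinAt, stress_one]
    have h1 : Tendsto (stress f σ) (𝓝[<] 1) (𝓝 σ) := by
      refine hf.limit.congr' ?_
      filter_upwards [self_mem_nhdsWithin] with x hx
      simp [stress, mem_Iio.1 hx]
    have h2 : Tendsto (stress f σ) (𝓝[≤] 1) (𝓝 σ) := by
      rw [← Iio_union_right, nhdsWithin_union, nhdsWithin_singleton]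
      refine h1.sup ?_
      have := tendsto_pure_nhds (stress f σ) 1
      rwa [stress_one] at this
    exact h2.mono_left (nhdsWithin_mono _ fun x hx => hx.2)

lemma strictMonoOn_stress (hf : Assumptions f σ) : StrictMonoOn (stress f σ) (Icc 0 1) := by
  apply strictMonoOn_of_deriv_pos (convex_Icc 0 1) (continuousOn_stress hf)
  intro b hb
  rw [interior_Icc] at hb
  have : stress f σ =ᶠ[𝓝 b] fun t => (1 - t) * f t := by
    filter_upwards [Iio_mem_nhds hb.2] with x hx
    simp [stress, mem_Iio.1 hx]
  rw [this.deriv_eq]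
  exact hf.deriv_pos b hb

lemma sqrt_min_mem (w : ℝ) : 1 - √(min w 1) ∈ Icc (0 : ℝ) 1 := by
  have : √(min w 1) ≤ 1 := Real.sqrt_le_one.2 (min_le_right _ _)
  constructor <;> linarith [Real.sqrt_nonneg (min w 1)]

lemma continuous_stressSq (hf : Assumptions f σ) : Continuous (stressSq f σ) :=
  (continuousOn_stress hf).comp_continuous
    (continuous_const.sub (continuous_id.min continuous_const).sqrt) sqrt_min_mem

lemma antitone_stressSq (hf : Assumptions f σ) : Antitone (stressSq f σ) := by
  intro v w h
  refine (strictMonoOn_stress hf).monotoneOn (sqrt_min_mem w) (sqrt_min_mem v) ?_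
  have : √(min v 1) ≤ √(min w 1) := Real.sqrt_le_sqrt (min_le_min_right 1 h)
  linarith

lemma strictAntiOn_stressSq (hf : Assumptions f σ) : StrictAntiOn (stressSq f σ) (Icc 0 1) := by
  intro v hv w hw h
  refine strictMonoOn_stress hf (sqrt_min_mem w) (sqrt_min_mem v) ?_
  have : √(min v 1) < √(min w 1) := by
    rw [min_eq_left hv.2, min_eq_left hw.2]
    exact Real.sqrt_lt_sqrt hv.1 h
  linarith

lemma stressSq_zero : stressSq f σ 0 = σ := by simp [stressSq, stress_one]

lemma stressSq_one (hf : Assumptions f σ) : stressSq f σ 1 = 0 := by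
  simp [stressSq, stress_zero hf]

lemma stressSq_le (hf : Assumptions f σ) (w : ℝ) : stressSq f σ w ≤ σ := by
  have := (strictMonoOn_stress hf).monotoneOn (sqrt_min_mem w) (by simp) (sqrt_min_mem w).2
  rwa [stress_one] at this

lemma stressSq_nonneg (hf : Assumptions f σ) (w : ℝ) : 0 ≤ stressSq f σ w := by
  have := (strictMonoOn_stress hf).monotoneOn (by simp) (sqrt_min_mem w) (sqrt_min_mem w).1
  rwa [stress_zero hf] at this

lemma stressSq_pos (hf : Assumptions f σ) {w : ℝ} (hw : w < 1) : 0 < stressSq f σ w := by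
  refine lt_of_lt_of_le ?_ (antitone_stressSq hf (le_max_left w 0))
  have h := strictAntiOn_stressSq hf ⟨le_max_right w 0, max_le hw.le zero_le_one⟩
    (right_mem_Icc.2 zero_le_one) (max_lt hw zero_lt_one)
  rwa [stressSq_one hf] at h

lemma stressSq_eq {w : ℝ} (hw : w ∈ Ioc (0 : ℝ) 1) :
    stressSq f σ w = √w * f (1 - √w) := by
  have : 0 < √w := Real.sqrt_pos.2 hw.1
  rw [stressSq, min_eq_left hw.2, stress, if_pos (by linarith)]
  ring

lemma stressSq_one_sub_sq {b : ℝ} (hb : b ∈ Icc (0 : ℝ) 1) :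
    stressSq f σ ((1 - b) ^ 2) = stress f σ b := by
  rw [stressSq, min_eq_left, Real.sqrt_sq (by linarith [hb.2])]
  · ring_nf
  · nlinarith [hb.1, hb.2]

/-- Assumption (f6) covers `(0,1]`; the endpoint `0` is reached by replacing each point `z` with
`max z ε` and letting `ε → 0⁺`. -/
lemma convexOn_stressSq (hf : Assumptions f σ) : ConvexOn ℝ (Icc 0 1) (stressSq f σ) := by
  have hc := continuous_stressSq hf
  have h0 : ConvexOn ℝ (Ioc 0 1) (stressSq f σ) := hf.convex.congr fun w hw => (stressSq_eq hw).symm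
  refine ⟨convex_Icc 0 1, fun x hx y hy a b ha hb hab => ?_⟩
  have hlim : ∀ z : ℝ, Tendsto (fun ε : ℝ => max z ε) (𝓝[>] 0) (𝓝 (max z 0)) := fun z =>
    ((continuous_const.max continuous_id).tendsto 0).mono_left nhdsWithin_le_nhds
  have hlx := hlim x
  have hly := hlim y
  rw [max_eq_left hx.1] at hlx
  rw [max_eq_left hy.1] at hly
  have l1 := (hc.tendsto _).comp ((hlx.const_smul a).add (hly.const_smul b))
  have l2 := (((hc.tendsto _).comp hlx).const_smul a).add (((hc.tendsto _).comp hly).const_smul b)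
  refine le_of_tendsto_of_tendsto l1 l2 ?_
  filter_upwards [Ioo_mem_nhdsGT (zero_lt_one (α := ℝ))] with ε hε
  exact h0.2 ⟨lt_max_of_lt_right hε.1, max_le hx.2 hε.2.le⟩
    ⟨lt_max_of_lt_right hε.1, max_le hy.2 hε.2.le⟩ ha hb hab

lemma stressSq_le_chord (hf : Assumptions f σ) {w : ℝ} (hw : w ∈ Icc (0 : ℝ) 1) :
    stressSq f σ w ≤ (1 - w) * σ := by
  have := (convexOn_stressSq hf).2 (x := 0) (by simp) (y := 1) (by simp)
    (sub_nonneg.2 hw.2) hw.1 (by ring)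
  simpa [stressSq_zero, stressSq_one hf] using this

/-- The width of the superlevel set of `stressSq`, i.e. its inverse function on `[0, σ]`. -/
def width (f : ℝ → ℝ) (σ y : ℝ) : ℝ := sInf {w ∈ Icc (0 : ℝ) 1 | stressSq f σ w ≤ y}

lemma width_mem_set (hf : Assumptions f σ) {y : ℝ} (hy : 0 ≤ y) :
    width f σ y ∈ {w ∈ Icc (0 : ℝ) 1 | stressSq f σ w ≤ y} := by
  refine IsClosed.csInf_mem ?_ ⟨1, by simp [stressSq_one hf, hy]⟩ ⟨0, fun w hw => hw.1.1⟩
  exact isClosed_Icc.inter (isClosed_le (continuous_stressSq hf) continuous_const)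

lemma width_mem (hf : Assumptions f σ) {y : ℝ} (hy : 0 ≤ y) : width f σ y ∈ Icc (0 : ℝ) 1 :=
  (width_mem_set hf hy).1

lemma width_le_iff (hf : Assumptions f σ) {y w : ℝ} (hy : 0 ≤ y) (hw : w ∈ Icc (0 : ℝ) 1) :
    width f σ y ≤ w ↔ stressSq f σ w ≤ y :=
  ⟨fun h => (antitone_stressSq hf h).trans (width_mem_set hf hy).2,
    fun h => csInf_le ⟨0, fun _ hw => hw.1.1⟩ ⟨hw, h⟩⟩

lemma lt_width_iff (hf : Assumptions f σ) {y w : ℝ} (hy : 0 ≤ y) (hw : w ∈ Icc (0 : ℝ) 1) :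
    w < width f σ y ↔ y < stressSq f σ w := by
  rw [← not_le, width_le_iff hf hy hw, not_le]

lemma width_stressSq (hf : Assumptions f σ) {w : ℝ} (hw : w ∈ Icc (0 : ℝ) 1) :
    width f σ (stressSq f σ w) = w := by
  have h0 := stressSq_nonneg hf w
  have hm := width_mem_set hf h0
  refine le_antisymm ((width_le_iff hf h0 hw).2 le_rfl) ?_
  exact ((strictAntiOn_stressSq hf).le_iff_ge hm.1 hw).1 hm.2

lemma stressSq_width (hf : Assumptions f σ) {y : ℝ} (hy : y ∈ Icc 0 σ) :
    stressSq f σ (width f σ y) = y := by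
  obtain ⟨w, hw, rfl⟩ : y ∈ stressSq f σ '' Icc 0 1 := by
    apply intermediate_value_Icc' zero_le_one (continuous_stressSq hf).continuousOn
    rwa [stressSq_zero, stressSq_one hf]
  rw [width_stressSq hf hw]

lemma width_eq_zero (hf : Assumptions f σ) {y : ℝ} (hy : σ ≤ y) : width f σ y = 0 := by
  have h0 : 0 ≤ y := hf.limit_pos.le.trans hy
  refine le_antisymm ((width_le_iff hf h0 (by simp)).2 ?_) (width_mem hf h0).1
  rwa [stressSq_zero]

lemma width_pos (hf : Assumptions f σ) {y : ℝ} (h0 : 0 ≤ y) (hy : y < σ) : 0 < width f σ y := by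
  rw [lt_width_iff hf h0 (by simp), stressSq_zero]
  exact hy

lemma width_lt_one (hf : Assumptions f σ) {y : ℝ} (h0 : 0 < y) (hy : y ≤ σ) :
    width f σ y < 1 := by
  refine lt_of_le_of_ne (width_mem hf h0.le).2 fun h => ?_
  have := stressSq_width hf ⟨h0.le, hy⟩
  rw [h, stressSq_one hf] at this
  exact h0.ne this

lemma antitoneOn_width (hf : Assumptions f σ) : AntitoneOn (width f σ) (Ici 0) := by
  intro x hx y hy h
  exact (width_le_iff hf hy (width_mem hf hx)).2 ((width_mem_set hf hx).2.trans h)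

/-- The inverse of a decreasing convex function is convex: a convex combination of points of two
sublevel sets lies in the sublevel set of the combined level. -/
lemma convexOn_width (hf : Assumptions f σ) : ConvexOn ℝ (Ici 0) (width f σ) := by
  refine ⟨convex_Ici 0, fun x hx y hy a b ha hb hab => ?_⟩
  have h1 := width_mem_set hf hx
  have h2 := width_mem_set hf hy
  rw [width_le_iff hf (convex_Ici 0 hx hy ha hb hab) (convex_Icc 0 1 h1.1 h2.1 ha hb hab)]
  refine ((convexOn_stressSq hf).2 h1.1 h2.1 ha hb hab).trans ?_
  simp only [smul_eq_mul]
  gcongr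
  · exact h1.2
  · exact h2.2

/-- Inverse form of the chord bound `stressSq_le_chord`. -/
lemma width_le (hf : Assumptions f σ) {y : ℝ} (hy : y ∈ Icc 0 σ) :
    width f σ y ≤ 1 - y / σ := by
  have h := stressSq_le_chord hf (width_mem hf hy.1)
  rw [stressSq_width hf hy] at h
  have := hf.limit_pos
  rw [le_sub_iff_add_le, ← le_sub_iff_add_le', div_le_iff₀ this]
  linarith

/-! ### Envelope theorem -/

/-- Envelope theorem for the Legendre-type transform `s ↦ min_c (c s + Φ c)` of a strictly convex
function on a compact interval. -/
lemma exists_minimizer_hasDerivAt {Φ : ℝ → ℝ} {σ : ℝ} (hσ : 0 ≤ σ)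
    (hc : ContinuousOn Φ (Icc 0 σ)) (hconv : StrictConvexOn ℝ (Icc 0 σ) Φ) :
    ∃ c : ℝ → ℝ, Continuous c ∧ (∀ s, c s ∈ Icc 0 σ) ∧
      (∀ s, ∀ x ∈ Icc 0 σ, x * s + Φ x ≤ c s * s + Φ (c s) → x = c s) ∧
      (∀ s, ∀ x ∈ Icc 0 σ, c s * s + Φ (c s) ≤ x * s + Φ x) ∧
      ∀ s, HasDerivAt (fun s => c s * s + Φ (c s)) (c s) s := by
  have hex : ∀ s : ℝ, ∃ c ∈ Icc 0 σ, ∀ x ∈ Icc 0 σ, c * s + Φ c ≤ x * s + Φ x := by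
    intro s
    obtain ⟨c, hcm, hmin⟩ := isCompact_Icc.exists_isMinOn (nonempty_Icc.2 hσ)
      (((continuous_id.mul continuous_const).continuousOn (s := Icc 0 σ)).add hc
        (f := fun x : ℝ => x * s))
    exact ⟨c, hcm, fun x hx => hmin hx⟩
  choose c hcm hmin using hex
  have huniq : ∀ s, ∀ x ∈ Icc 0 σ, x * s + Φ x ≤ c s * s + Φ (c s) → x = c s := by
    intro s x hx hle
    by_contra hne
    have h0 : (0 : ℝ) < 1 / 2 := by norm_num
    have h1 := hconv.2 hx (hcm s) hne h0 h0 (by norm_num)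
    have h2 := hmin s _ (hconv.1 hx (hcm s) h0.le h0.le (by norm_num))
    simp only [smul_eq_mul] at h1 h2
    linarith
  -- By compactness it suffices that every cluster point of `c` at `s` is itself a minimizer at `s`;
  -- uniqueness then identifies it with `c s`.
  have hcont : Continuous c := by
    rw [continuous_iff_continuousAt]
    intro s
    refine isCompact_Icc.tendsto_nhds_of_unique_mapClusterPt (Eventually.of_forall hcm) ?_
    intro x hx hcl
    refine huniq s x hx ?_
    refine le_of_forall_pos_lt_add fun ε hε => ?_
    have e1 : ∀ᶠ y in 𝓝[Icc 0 σ] x, x * s + Φ x - ε / 3 < y * s + Φ y := by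
      have : ContinuousWithinAt (fun y => y * s + Φ y) (Icc 0 σ) x :=
        (continuous_id.mul continuous_const).continuousWithinAt.add (hc x hx)
      exact this.eventually (lt_mem_nhds (by linarith))
    have e2 : ∀ᶠ t in 𝓝 s, σ * |s - t| < ε / 3 := by
      have : Tendsto (fun t => σ * |s - t|) (𝓝 s) (𝓝 (σ * |s - s|)) :=
        Continuous.tendsto (by fun_prop) s
      simp only [sub_self, abs_zero, mul_zero] at this
      exact this.eventually (gt_mem_nhds (by linarith))
    rw [eventually_nhdsWithin_iff] at e1
    obtain ⟨t, ht1, ht2⟩ := ((hcl.frequently e1).and_eventually e2).exists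
    have h1 := ht1 (hcm t)
    have h2 := hmin t _ (hcm s)
    have h3 : c t * (s - t) ≤ σ * |s - t| := by
      calc c t * (s - t) ≤ c t * |s - t| := mul_le_mul_of_nonneg_left (le_abs_self _) (hcm t).1
        _ ≤ σ * |s - t| := mul_le_mul_of_nonneg_right (hcm t).2 (abs_nonneg _)
    have h4 : c s * (t - s) ≤ σ * |s - t| := by
      calc c s * (t - s) ≤ c s * |s - t| :=
            mul_le_mul_of_nonneg_left (by rw [abs_sub_comm]; exact le_abs_self _) (hcm s).1
        _ ≤ σ * |s - t| := mul_le_mul_of_nonneg_right (hcm s).2 (abs_nonneg _)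
    linarith
  refine ⟨c, hcont, hcm, huniq, hmin, fun s => ?_⟩
  rw [hasDerivAt_iff_isLittleO, Asymptotics.isLittleO_iff]
  intro ε hε
  have : ∀ᶠ t in 𝓝 s, |c t - c s| < ε := by
    have := Metric.tendsto_nhds.1 (hcont.tendsto s) ε hε
    simpa [Real.dist_eq] using this
  filter_upwards [this] with t ht
  -- Testing each minimizer at the other parameter traps the increment between `c t * (t - s)` and
  -- `c s * (t - s)`.
  have h1 := hmin t _ (hcm s)
  have h2 := hmin s _ (hcm t)
  simp only [smul_eq_mul, Real.norm_eq_abs]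
  have h3 : |(t - s) * (c t - c s)| ≤ ε * |t - s| := by
    rw [abs_mul, mul_comm]
    exact mul_le_mul_of_nonneg_right ht.le (abs_nonneg _)
  rw [abs_le] at h3 ⊢
  constructor <;> nlinarith [h3.1, h3.2, mul_pos hε hε, abs_nonneg (t - s)]

/-! ### The dual function `Φ` and its strict convexity -/

/-- The factor `√(1 - (c / H)²)` with `H = stressSq f σ`, extended by `0` to where `H ≤ c`. -/
def cofactor (f : ℝ → ℝ) (σ c w : ℝ) : ℝ := √(1 - (c / max (stressSq f σ w) c) ^ 2)

/-- The function `Φ` whose Legendre-type transform is the energy density. -/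
def legendre (f : ℝ → ℝ) (σ c : ℝ) : ℝ := ∫ w in (0 : ℝ)..1, cofactor f σ c w

lemma cofactor_nonneg (c w : ℝ) : 0 ≤ cofactor f σ c w := Real.sqrt_nonneg _

lemma cofactor_le_one (c w : ℝ) : cofactor f σ c w ≤ 1 := by
  rw [cofactor, Real.sqrt_le_one]
  nlinarith [sq_nonneg (c / max (stressSq f σ w) c)]

lemma cofactor_zero (w : ℝ) : cofactor f σ 0 w = 1 := by simp [cofactor]

lemma cofactor_eq_zero {c w : ℝ} (hc : 0 < c) (hw : stressSq f σ w ≤ c) :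
    cofactor f σ c w = 0 := by
  rw [cofactor, max_eq_right hw, div_self hc.ne']
  simp

lemma cofactor_eq {c w : ℝ} (hw : c ≤ stressSq f σ w) :
    cofactor f σ c w = √(1 - (c / stressSq f σ w) ^ 2) := by
  rw [cofactor, max_eq_left hw]

lemma continuous_cofactor (hf : Assumptions f σ) {c : ℝ} (hc : 0 ≤ c) :
    Continuous (cofactor f σ c) := by
  rcases hc.eq_or_lt with rfl | hc
  · have : cofactor f σ 0 = fun _ => 1 := funext cofactor_zero
    rw [this]
    exact continuous_const
  · refine (continuous_const.sub ((continuous_const.div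
      ((continuous_stressSq hf).max continuous_const) fun w => ?_).pow 2)).sqrt
    exact (hc.trans_le (le_max_right _ _)).ne'

lemma measurable_cofactor (hf : Assumptions f σ) (c : ℝ) : Measurable (cofactor f σ c) := by
  have := (continuous_stressSq hf).measurable
  unfold cofactor
  fun_prop

lemma intervalIntegrable_cofactor (hf : Assumptions f σ) (c a b : ℝ) :
    IntervalIntegrable (cofactor f σ c) volume a b := by
  refine (intervalIntegrable_const (c := (1 : ℝ))).mono_fun
    (measurable_cofactor hf c).aestronglyMeasurable (Eventually.of_forall fun w => ?_)
  simpa [abs_of_nonneg (cofactor_nonneg c w)] using cofactor_le_one c w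

lemma continuous_legendre (hf : Assumptions f σ) : Continuous (legendre f σ) := by
  refine intervalIntegral.continuous_of_dominated_interval (bound := fun _ => 1)
    (fun c => (measurable_cofactor hf c).aestronglyMeasurable)
    (fun c => Eventually.of_forall fun w _ => ?_) intervalIntegrable_const ?_
  · simpa [abs_of_nonneg (cofactor_nonneg c w)] using cofactor_le_one c w
  -- At `w = 1` the stress vanishes, so the quotient defining `cofactor` may degenerate at `c = 0`;
  -- one point is negligible.
  · have : ∀ᵐ w : ℝ, w ≠ 1 := by simp [ae_iff]
    filter_upwards [this] with w hw1 hw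
    rw [uIoc_of_le zero_le_one] at hw
    have hw' := stressSq_pos hf (lt_of_le_of_ne hw.2 hw1)
    refine (continuous_const.sub ((continuous_id.div
      (continuous_const.max continuous_id) fun c => ?_).pow 2)).sqrt
    exact (hw'.trans_le (le_max_left _ _)).ne'

lemma legendre_zero : legendre f σ 0 = 1 := by
  simp [legendre, cofactor_zero]

lemma legendre_nonneg (c : ℝ) : 0 ≤ legendre f σ c :=
  intervalIntegral.integral_nonneg zero_le_one fun w _ => cofactor_nonneg c w

lemma legendre_eq_integral_width (hf : Assumptions f σ) {c : ℝ} (hc : c ∈ Icc 0 σ) :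
    legendre f σ c = ∫ w in (0 : ℝ)..width f σ c, cofactor f σ c w := by
  have hm := width_mem hf hc.1
  rw [legendre, ← intervalIntegral.integral_add_adjacent_intervals
    (intervalIntegrable_cofactor hf c 0 (width f σ c)) (intervalIntegrable_cofactor hf c _ 1)]
  rcases hc.1.eq_or_lt with rfl | hc0
  · have : width f σ 0 = 1 := by
      have := width_stressSq hf (right_mem_Icc.2 zero_le_one)
      rwa [stressSq_one hf] at this
    simp [this]
  · rw [add_eq_left, intervalIntegral.integral_congr (g := fun _ => 0)]
    · simp
    · intro w hw
      rw [uIcc_of_le hm.2] at hw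
      exact cofactor_eq_zero hc0 ((width_le_iff hf hc.1 ⟨hm.1.trans hw.1, hw.2⟩).1 hw.1)

/-- Bounds the length of the support by `width_le` and the integrand by its value for `H = σ`. The
right side is `o(σ - c)` as `c → σ⁻`, which is what `minimizer_lt` needs. -/
lemma legendre_le (hf : Assumptions f σ) {c : ℝ} (hc : c ∈ Icc 0 σ) :
    legendre f σ c ≤ (1 - c / σ) * √(1 - (c / σ) ^ 2) := by
  have hσ := hf.limit_pos
  have hm := width_mem hf hc.1
  rw [legendre_eq_integral_width hf hc]
  calc ∫ w in (0 : ℝ)..width f σ c, cofactor f σ c w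
      ≤ ∫ w in (0 : ℝ)..width f σ c, √(1 - (c / σ) ^ 2) := by
        refine intervalIntegral.integral_mono_on hm.1 (intervalIntegrable_cofactor hf c _ _)
          intervalIntegrable_const fun w hw => ?_
        have hw' : max (stressSq f σ w) c ≤ σ := max_le (stressSq_le hf w) hc.2
        rcases hc.1.eq_or_lt with rfl | hc0
        · simp [cofactor]
        · have : 0 < max (stressSq f σ w) c := hc0.trans_le (le_max_right _ _)
          unfold cofactor
          gcongr
    _ = width f σ c * √(1 - (c / σ) ^ 2) := by simp
    _ ≤ _ := mul_le_mul_of_nonneg_right (width_le hf hc) (Real.sqrt_nonneg _)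

lemma legendre_right (hf : Assumptions f σ) : legendre f σ σ = 0 := by
  have := hf.limit_pos
  refine le_antisymm ?_ (legendre_nonneg σ)
  have h := legendre_le hf (right_mem_Icc.2 this.le)
  rwa [div_self this.ne', sub_self, zero_mul] at h

/-- Identifies the superlevel sets of `cofactor` as intervals starting at `0`, as needed for layer
cake. -/
lemma lt_cofactor_iff (hf : Assumptions f σ) {c u w : ℝ} (hc : 0 ≤ c) (hu : u ∈ Ioo (0 : ℝ) 1)
    (hw : w ∈ Ioo (0 : ℝ) 1) : u < cofactor f σ c w ↔ w < width f σ (c / √(1 - u ^ 2)) := by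
  have h1 : 0 < 1 - u ^ 2 := by nlinarith [hu.1, hu.2]
  have h2 := Real.sqrt_pos.2 h1
  have h3 : √(1 - u ^ 2) < 1 := by
    rw [Real.sqrt_lt' one_pos]
    nlinarith [hu.1]
  have hH := stressSq_pos hf hw.2
  have hM : 0 < max (stressSq f σ w) c := hH.trans_le (le_max_left _ _)
  rw [lt_width_iff hf (by positivity) ⟨hw.1.le, hw.2.le⟩, cofactor, Real.lt_sqrt hu.1.le,
    lt_sub_comm, ← Real.lt_sqrt (by positivity), div_lt_comm₀ hM h2, lt_max_iff, or_iff_left_iff_imp]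
  intro h
  exfalso
  rw [div_lt_iff₀ h2] at h
  nlinarith

lemma measurable_width_comp (hf : Assumptions f σ) {φ : ℝ → ℝ} (hφ : Measurable φ)
    (h0 : ∀ u, 0 ≤ φ u) : Measurable fun u => width f σ (φ u) := by
  have h1 : Antitone fun y => width f σ (max y 0) := fun x y h =>
    antitoneOn_width hf (mem_Ici.2 (le_max_right _ _)) (mem_Ici.2 (le_max_right _ _)) (max_le_max_right 0 h)
  have h2 := h1.measurable.comp hφ
  have : (fun u => width f σ (φ u)) = (fun y => width f σ (max y 0)) ∘ φ := by
    ext u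
    simp [max_eq_left (h0 u)]
  rwa [this]

lemma intervalIntegrable_width (hf : Assumptions f σ) {c : ℝ} (hc : 0 ≤ c) (a b : ℝ) :
    IntervalIntegrable (fun u => width f σ (c / √(1 - u ^ 2))) volume a b := by
  have h0 : ∀ u : ℝ, 0 ≤ c / √(1 - u ^ 2) := fun u => by positivity
  refine (intervalIntegrable_const (c := (1 : ℝ))).mono_fun
    (measurable_width_comp hf (by fun_prop) h0).aestronglyMeasurable
    (Eventually.of_forall fun u => ?_)
  have := width_mem hf (h0 u)
  simpa [abs_of_nonneg this.1] using this.2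

/-- Layer cake representation. -/
lemma legendre_eq_integral (hf : Assumptions f σ) {c : ℝ} (hc : 0 ≤ c) :
    legendre f σ c = ∫ u in (0 : ℝ)..1, width f σ (c / √(1 - u ^ 2)) := by
  have hi : Integrable (cofactor f σ c) (volume.restrict (Ioo 0 1)) :=
    ((intervalIntegrable_iff_integrableOn_Ioo_of_le zero_le_one).1
      (intervalIntegrable_cofactor hf c 0 1))
  rw [legendre, intervalIntegral.integral_of_le zero_le_one, ← integral_Ioc_eq_integral_Ioo.symm,
    hi.integral_eq_integral_meas_lt (Eventually.of_forall fun w => cofactor_nonneg c w),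
    intervalIntegral.integral_of_le zero_le_one, integral_Ioc_eq_integral_Ioo]
  refine (setIntegral_eq_of_subset_of_forall_sdiff_eq_zero measurableSet_Ioi
    Ioo_subset_Ioi_self (t := Ioi 0) (s := Ioo 0 1) ?_).trans ?_
  rotate_left
  · refine setIntegral_congr_fun measurableSet_Ioo fun u hu => ?_
    have hy : 0 ≤ c / √(1 - u ^ 2) := by positivity
    have hm := width_mem hf hy
    have : {w | u < cofactor f σ c w} ∩ Ioo 0 1 = Ioo 0 (width f σ (c / √(1 - u ^ 2))) := by
      ext w
      constructor
      · rintro ⟨h1, h2⟩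
        exact ⟨h2.1, (lt_cofactor_iff hf hc hu h2).1 h1⟩
      · rintro ⟨h1, h2⟩
        have h3 : w ∈ Ioo (0 : ℝ) 1 := ⟨h1, h2.trans_le hm.2⟩
        exact ⟨(lt_cofactor_iff hf hc hu h3).2 h2, h3⟩
    simp only [Measure.real]
    rw [Measure.restrict_apply (measurableSet_lt measurable_const (measurable_cofactor hf c)),
      this, Real.volume_Ioo, sub_zero, ENNReal.toReal_ofReal hm.1]
  · intro u hu
    have hu1 : 1 ≤ u := by
      by_contra h
      exact hu.2 ⟨hu.1, not_le.1 h⟩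
    have : {w | u < cofactor f σ c w} = ∅ := by
      ext w
      simp only [mem_ofPred_eq, mem_empty_iff_false, iff_false, not_lt]
      exact (cofactor_le_one c w).trans hu1
    rw [this]
    simp

/-- For each `u` the layer-cake integrand is convex in `c`. Strictness comes from the kink of
`width` at `σ`: for a range of `u`, the rescaled middle point is already beyond `σ` while the left
one is not. -/
lemma strictConvexOn_legendre (hf : Assumptions f σ) :
    StrictConvexOn ℝ (Icc 0 σ) (legendre f σ) := by
  have hσ := hf.limit_pos
  apply LinearOrder.strictConvexOn_of_lt (convex_Icc 0 σ)
  intro x hx y hy hxy a b ha hb hab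
  set c := a * x + b * y with hc
  have hc0 : 0 ≤ c := by have := hx.1; have := hy.1; positivity
  have hxc : x < c := by
    have : x = a * x + b * x := by rw [← add_mul, hab, one_mul]
    nlinarith
  have hcy : c < y := by
    have : y = a * y + b * y := by rw [← add_mul, hab, one_mul]
    nlinarith
  have hcpos : 0 < c := hx.1.trans_lt hxc
  have hcσ : c < σ := hcy.trans_le hy.2
  simp only [smul_eq_mul]
  rw [← hc, legendre_eq_integral hf hc0, legendre_eq_integral hf hx.1, legendre_eq_integral hf hy.1]
  have ix := intervalIntegrable_width hf hx.1
  have iy := intervalIntegrable_width hf hy.1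
  have ic := intervalIntegrable_width hf hc0
  rw [← intervalIntegral.integral_const_mul, ← intervalIntegral.integral_const_mul,
    ← intervalIntegral.integral_add ((ix 0 1).const_mul a) ((iy 0 1).const_mul b), ← sub_pos,
    ← intervalIntegral.integral_sub (((ix 0 1).const_mul a).add ((iy 0 1).const_mul b)) (ic 0 1)]
  set D : ℝ → ℝ := fun u => a * width f σ (x / √(1 - u ^ 2)) + b * width f σ (y / √(1 - u ^ 2)) -
    width f σ (c / √(1 - u ^ 2)) with hD
  have hDi : ∀ s t, IntervalIntegrable D volume s t := fun s t =>
    (((ix s t).const_mul a).add ((iy s t).const_mul b)).sub (ic s t)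
  have hD0 : ∀ u, 0 ≤ D u := by
    intro u
    have h1 : 0 ≤ x / √(1 - u ^ 2) := div_nonneg hx.1 (Real.sqrt_nonneg _)
    have h2 : 0 ≤ y / √(1 - u ^ 2) := div_nonneg hy.1 (Real.sqrt_nonneg _)
    have h := (convexOn_width hf).2 h1 h2 ha.le hb.le hab
    simp only [smul_eq_mul] at h
    have e : a * (x / √(1 - u ^ 2)) + b * (y / √(1 - u ^ 2)) = c / √(1 - u ^ 2) := by
      rw [hc]; ring
    rw [e] at h
    simp only [hD]
    linarith
  -- These are the values of `u` at which `c / √(1 - u²)` and `x / √(1 - u²)` reach `σ`; between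
  -- them the convexity defect `D` is positive.
  set u₁ := √(1 - (c / σ) ^ 2) with hu₁
  set u₂ := √(1 - (x / σ) ^ 2) with hu₂
  have hcσ1 : c / σ < 1 := (div_lt_one hσ).2 hcσ
  have hxσ : x / σ < c / σ := (div_lt_div_iff_of_pos_right hσ).2 hxc
  have hx0 : 0 ≤ x / σ := div_nonneg hx.1 hσ.le
  have hlt : u₁ < u₂ := by
    apply Real.sqrt_lt_sqrt
    · nlinarith
    · nlinarith
  have h01 : 0 ≤ u₁ := Real.sqrt_nonneg _
  have h21 : u₂ ≤ 1 := by
    rw [hu₂, Real.sqrt_le_one]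
    nlinarith
  calc 0 < ∫ u in u₁..u₂, D u := by
        apply intervalIntegral.intervalIntegral_pos_of_pos_on (hDi _ _) _ hlt
        intro u hu
        have hu0 : 0 < u := h01.trans_lt hu.1
        have hu1 : u < 1 := hu.2.trans_le h21
        have hpos : 0 < √(1 - u ^ 2) := Real.sqrt_pos.2 (by nlinarith)
        have e1 : σ ≤ c / √(1 - u ^ 2) := by
          rw [le_div_iff₀ hpos, mul_comm, ← le_div_iff₀ hσ]
          rw [Real.sqrt_le_left (by positivity)]
          have := (Real.sqrt_lt' hu0).1 hu.1
          linarith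
        have e2 : x / √(1 - u ^ 2) < σ := by
          rw [div_lt_iff₀ hpos, mul_comm, ← div_lt_iff₀ hσ]
          rw [Real.lt_sqrt hx0]
          have := (Real.lt_sqrt hu0.le).1 hu.2
          linarith
        have e3 := width_eq_zero hf e1
        have e4 := width_pos hf (div_nonneg hx.1 hpos.le) e2
        have e5 := (width_mem hf (div_nonneg hy.1 hpos.le)).1
        simp only [hD, e3]
        have := mul_pos ha e4
        have := mul_nonneg hb.le e5
        linarith
    _ ≤ ∫ u in (0 : ℝ)..1, D u :=
        intervalIntegral.integral_mono_interval h01 hlt.le h21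
          (Eventually.of_forall hD0) (hDi _ _)

/-! ### Calibration and the lower bound -/

/-- Young's inequality gives `p² + r² ≥ 2 p r` with `r = k x|a| + q|v|`, and Cauchy–Schwarz with the
unit vector `(k, q)` gives `r² ≤ x²a² + v²`. -/
lemma calibration_real {h c x a v p k q : ℝ} (hk : k ^ 2 + q ^ 2 = 1) (hkh : k * h = c)
    (hp : 2 * p * x = h) :
    c * |a| + q * (2 * p) * |v| ≤ x ^ 2 * a ^ 2 + p ^ 2 + v ^ 2 := by
  have h1 : (k * (x * |a|) + q * |v|) ^ 2 ≤ x ^ 2 * a ^ 2 + v ^ 2 := by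
    rw [← sq_abs a, ← sq_abs v]
    nlinarith [sq_nonneg (q * (x * |a|) - k * |v|)]
  have h2 : c * |a| + q * (2 * p) * |v| = 2 * p * (k * (x * |a|) + q * |v|) := by
    rw [← hkh, ← hp]; ring
  nlinarith [sq_nonneg (p - (k * (x * |a|) + q * |v|))]

/-- Pointwise calibration inequality. -/
lemma calibration (hf : Assumptions f σ) {b₀ b : ℝ} (h₀ : b₀ ∈ Icc (0 : ℝ) 1)
    (hb : b ∈ Icc (0 : ℝ) 1) (hle : b₀ ≤ b) (a v : ℝ) :
    ENNReal.ofReal (stress f σ b₀ * |a|) +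
      ENNReal.ofReal (cofactor f σ (stress f σ b₀) ((1 - b) ^ 2) * (1 - b) * |v|) ≤
    coeff f b * ENNReal.ofReal (a ^ 2) + ENNReal.ofReal ((1 - b) ^ 2 / 4) +
      ENNReal.ofReal (v ^ 2) := by
  set c := stress f σ b₀ with hc
  have hc0 : 0 ≤ c := by
    have := (strictMonoOn_stress hf).monotoneOn (by simp) h₀ h₀.1
    rwa [stress_zero hf] at this
  have hch : c ≤ stress f σ b := (strictMonoOn_stress hf).monotoneOn h₀ hb hle
  rcases lt_or_eq_of_le hb.2 with hb1 | rfl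
  · have hq := Real.sqrt_nonneg (1 - (c / stress f σ b) ^ 2)
    have hk : (c / stress f σ b) ^ 2 ≤ 1 := by
      rw [sq_le_one_iff_abs_le_one, abs_of_nonneg (div_nonneg hc0 (hc0.trans hch))]
      exact div_le_one_of_le₀ hch (hc0.trans hch)
    have key := calibration_real (h := stress f σ b) (c := c) (x := f b) (a := a) (v := v)
      (p := (1 - b) / 2) (k := c / stress f σ b) (q := √(1 - (c / stress f σ b) ^ 2))
      (by rw [Real.sq_sqrt (by linarith)]; ring)
      (by
        -- If the stress at `b` is zero then so is `c`, and the convention `0 / 0 = 0` is harmless.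
        rcases (hc0.trans hch).eq_or_lt with h | h
        · have : c = 0 := le_antisymm (by rw [h]; exact hch) hc0
          simp [this]
        · exact div_mul_cancel₀ _ h.ne')
      (by rw [stress, if_pos hb1]; ring)
    rw [cofactor_eq (by rwa [stressSq_one_sub_sq hb]), stressSq_one_sub_sq hb, coeff, if_pos hb1,
      ← ENNReal.ofReal_mul (sq_nonneg _), ← ENNReal.ofReal_add (by positivity)
        (mul_nonneg (mul_nonneg hq (by linarith)) (abs_nonneg _)),
      ← ENNReal.ofReal_add (by positivity) (by positivity),
      ← ENNReal.ofReal_add (by positivity) (by positivity)]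
    apply ENNReal.ofReal_le_ofReal
    convert key using 1 <;> ring
  -- At `b = 1` the coefficient is `⊤`: either `a = 0` and the left side vanishes, or the right side
  -- is infinite.
  · by_cases ha : a = 0
    · simp [ha]
    · have : 0 < a ^ 2 := by positivity
      have h2 : ENNReal.ofReal (a ^ 2) ≠ 0 := by simpa using ha
      simp [coeff, ENNReal.top_mul h2]

/-- Every admissible pair whose phase field has minimum `b` satisfies the calibration bound. -/
lemma le_energy (hf : Assumptions f σ) {s b : ℝ} {p : (ℝ → ℝ) × (ℝ → ℝ)} (hp : p ∈ admissible s)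
    (hb : IsLeast (range p.2) b) :
    ENNReal.ofReal (stress f σ b * s + legendre f σ (stress f σ b)) ≤ energy f p := by
  obtain ⟨α, β⟩ := p
  obtain ⟨-, ⟨hβc, hβw, -⟩, hai, hs, hβ01, hβlim⟩ := hp
  simp only at *
  obtain ⟨⟨t₀, ht₀⟩, hmin⟩ := hb
  have hle : ∀ t, b ≤ β t := fun t => hmin (mem_range_self t)
  have hb01 : b ∈ Icc (0 : ℝ) 1 := ht₀ ▸ hβ01 t₀
  set c := stress f σ b with hc
  have hcm : c ∈ Icc 0 σ := by
    rw [hc, ← stressSq_one_sub_sq hb01]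
    exact ⟨stressSq_nonneg hf _, stressSq_le hf _⟩
  have hW : width f σ c = (1 - b) ^ 2 := by
    rw [hc, ← stressSq_one_sub_sq hb01]
    apply width_stressSq hf
    constructor <;> nlinarith [hb01.1, hb01.2]
  set v := weakDeriv β with hv
  set a := weakDeriv α with ha
  have hqc := continuous_cofactor hf hcm.1
  set F' : ℝ → ℝ := fun x => cofactor f σ c ((1 - x) ^ 2) * (1 - x) with hF'
  -- The substitution `w = (1 - x)²` turns the phase-field term of the calibration into the
  -- derivative of `F ∘ β`. Here `F 1 = 0` and `F b = -Φ(c)/2`.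
  set F : ℝ → ℝ := fun x => -(1 / 2) * ∫ w in (0 : ℝ)..(1 - x) ^ 2, cofactor f σ c w with hF
  have hF'c : Continuous F' := (hqc.comp (by fun_prop)).mul (by fun_prop)
  have hFd : ∀ x, HasDerivAt F (F' x) x := by
    intro x
    have h1 : HasDerivAt (fun y => ∫ w in (0 : ℝ)..y, cofactor f σ c w)
        (cofactor f σ c ((1 - x) ^ 2)) ((1 - x) ^ 2) :=
      intervalIntegral.integral_hasDerivAt_right (hqc.intervalIntegrable _ _)
        (hqc.stronglyMeasurableAtFilter _ _) hqc.continuousAt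
    have h2 : HasDerivAt (fun x : ℝ => (1 - x) ^ 2) (2 * (1 - x) ^ 1 * (-1)) x := by
      convert! ((hasDerivAt_id x).const_sub 1).pow 2 using 1
    have := (h1.comp x h2).const_mul (-(1 / 2))
    convert! this using 1
    simp only [hF']
    ring
  have hFc : Continuous F := continuous_iff_continuousAt.2 fun x => (hFd x).continuousAt
  have hF'0 : ∀ t, 0 ≤ F' (β t) := fun t =>
    mul_nonneg (cofactor_nonneg _ _) (by linarith [(hβ01 t).2])
  have hF1 : F 1 = 0 := by simp [hF]
  have hFb : F b = -(1 / 2) * legendre f σ c := by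
    rw [legendre_eq_integral_width hf hcm, hW]
  have hpt := lintegral_mono (μ := volume) fun t => calibration hf hb01 (hβ01 t) (hle t) (a t) (v t)
  refine le_trans ?_ hpt
  have ham : AEMeasurable fun t => ENNReal.ofReal (c * |a t|) :=
    (hai.abs.const_mul c).aestronglyMeasurable.aemeasurable.ennreal_ofReal
  rw [lintegral_add_left' ham]
  have hs0 : 0 ≤ s := hs ▸ abs_nonneg _
  rw [ENNReal.ofReal_add (mul_nonneg hcm.1 hs0) (legendre_nonneg _)]
  gcongr
  · rw [← ofReal_integral_eq_lintegral_ofReal (hai.abs.const_mul c)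
      (Eventually.of_forall fun t => mul_nonneg hcm.1 (abs_nonneg _)), integral_const_mul, ← hs]
    apply ENNReal.ofReal_le_ofReal
    exact mul_le_mul_of_nonneg_left (abs_integral_le_integral_abs) hcm.1
  -- Each half line from the minimum point contributes `F 1 - F b = Φ(c)/2`.
  · have hlim : Tendsto (fun T => F (β T) + F (β (-T)) - 2 * F b) atTop
        (𝓝 (legendre f σ c)) := by
      have h1 : Tendsto β atTop (𝓝 1) := hβlim.mono_left atTop_le_cocompact
      have h2 : Tendsto (fun T => β (-T)) atTop (𝓝 1) :=
        (hβlim.mono_left atBot_le_cocompact).comp tendsto_neg_atTop_atBot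
      have := (((hFc.tendsto 1).comp h1).add ((hFc.tendsto 1).comp h2)).sub_const (2 * F b)
      convert! this using 2
      rw [hF1, hFb]
      ring
    refine le_of_tendsto ((ENNReal.continuous_ofReal.tendsto _).comp hlim) ?_
    filter_upwards [eventually_ge_atTop |t₀|] with T hT
    have hT' := abs_le.1 hT
    have hvi : ∀ x y, IntervalIntegrable (fun t => F' (β t) * v t) volume x y := fun x y =>
      (IntervalIntegrable.continuousOn_mul
        ((hβw.2.1.integrableOn_isCompact isCompact_uIcc).intervalIntegrable)
        (hF'c.comp hβc).continuousOn)
    have e1 := integral_comp_mul_weakDeriv hβc hβw hFd hF'c t₀ T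
    have e2 := integral_comp_mul_weakDeriv hβc hβw hFd hF'c (-T) t₀
    rw [ht₀] at e1 e2
    have e3 : F (β T) - F b ≤ ∫ t in t₀..T, |F' (β t) * v t| := by
      rw [← e1]
      exact (le_abs_self _).trans (intervalIntegral.abs_integral_le_integral_abs hT'.2)
    have e4 : F (β (-T)) - F b ≤ ∫ t in (-T)..t₀, |F' (β t) * v t| := by
      have : F (β (-T)) - F b = -(F b - F (β (-T))) := by ring
      rw [this, ← e2]
      exact (neg_le_abs _).trans (intervalIntegral.abs_integral_le_integral_abs hT'.1)
    have e5 : F (β T) + F (β (-T)) - 2 * F b ≤ ∫ t in (-T)..T, |F' (β t) * v t| := by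
      rw [← intervalIntegral.integral_add_adjacent_intervals (hvi (-T) t₀).abs (hvi t₀ T).abs]
      linarith
    refine (ENNReal.ofReal_le_ofReal e5).trans ?_
    have hTT : -T ≤ T := by linarith
    rw [intervalIntegral.integral_of_le hTT, ofReal_integral_eq_lintegral_ofReal]
    · refine (setLIntegral_le_lintegral _ _).trans (le_of_eq ?_)
      congr 1
      ext t
      rw [abs_mul, abs_of_nonneg (hF'0 t)]
    · exact ((intervalIntegrable_iff_integrableOn_Ioc_of_le hTT).1 (hvi (-T) T).abs)
    · exact Eventually.of_forall fun t => abs_nonneg _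

lemma exists_isLeast {s : ℝ} {p : (ℝ → ℝ) × (ℝ → ℝ)} (hp : p ∈ admissible s) :
    ∃ b ∈ Icc (0 : ℝ) 1, IsLeast (range p.2) b := by
  obtain ⟨-, ⟨hβc, -, -⟩, -, -, hβ01, hβlim⟩ := hp
  suffices ∃ t₀, ∀ t, p.2 t₀ ≤ p.2 t by
    obtain ⟨t₀, h⟩ := this
    exact ⟨p.2 t₀, hβ01 t₀, mem_range_self _, by rintro _ ⟨t, rfl⟩; exact h t⟩
  by_cases h : ∃ t₁, p.2 t₁ < 1
  · obtain ⟨t₁, h⟩ := h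
    refine hβc.exists_forall_le' t₁ ?_
    filter_upwards [hβlim.eventually (lt_mem_nhds h)] with t ht using ht.le
  · push Not at h
    exact ⟨0, fun t => (hβ01 0).2.trans (h t)⟩

/-! ### Even pairs from data on the half line -/

lemma lintegral_comp_abs (φ : ℝ → ℝ≥0∞) :
    ∫⁻ t, φ |t| = 2 * ∫⁻ t in Ioi (0 : ℝ), φ t := by
  have h1 : ∫⁻ t in Ioi (0 : ℝ), φ |t| = ∫⁻ t in Ioi (0 : ℝ), φ t :=
    setLIntegral_congr_fun measurableSet_Ioi fun t ht => by rw [abs_of_pos ht]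
  have h2 : ∫⁻ t in Iio (0 : ℝ), φ |t| = ∫⁻ t in Ioi (0 : ℝ), φ t := by
    have := (Measure.measurePreserving_neg (volume : Measure ℝ)).setLIntegral_comp_preimage_emb
      (Homeomorph.neg ℝ).measurableEmbedding φ (Ioi 0)
    rw [← this]
    have e : (Neg.neg : ℝ → ℝ) ⁻¹' Ioi 0 = Iio 0 := by ext; simp
    rw [e]
    exact setLIntegral_congr_fun measurableSet_Iio fun t ht => by rw [abs_of_neg ht]
  rw [← lintegral_add_compl _ (measurableSet_Ioi (a := (0 : ℝ))), compl_Ioi,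
    setLIntegral_congr Iio_ae_eq_Iic.symm, h1, h2, two_mul]

lemma integrable_comp_abs {φ : ℝ → ℝ} (hm : Measurable φ) (h : IntegrableOn φ (Ioi 0)) :
    Integrable fun t => φ |t| := by
  refine ⟨(hm.comp continuous_abs.measurable).aestronglyMeasurable, ?_⟩
  rw [HasFiniteIntegral, lintegral_comp_abs fun t => ‖φ t‖ₑ]
  exact ENNReal.mul_lt_top (by simp) h.2

/-- Even extensions of piecewise differentiable functions with bounded derivative. -/
lemma memH1Loc_comp_abs {u v : ℝ → ℝ} {S : Set ℝ} {C : ℝ} (hu : Continuous u) (hv : Measurable v)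
    (hC : ∀ t, 0 ≤ t → |v t| ≤ C) (hS : S.Countable) (hd : ∀ t, 0 < t → t ∉ S → HasDerivAt u (v t) t) :
    MemH1Loc (fun t => u |t|) ∧
      ∀ᵐ t, weakDeriv (fun t => u |t|) t ^ 2 = v |t| ^ 2 := by
  set w : ℝ → ℝ := fun t => SignType.sign t * v |t| with hw
  have hsm : Measurable fun t : ℝ => ((SignType.sign t : SignType) : ℝ) := by
    have : (fun t : ℝ => ((SignType.sign t : SignType) : ℝ)) =
        fun t => if t < 0 then -1 else if 0 < t then 1 else 0 := by
      ext t
      rcases lt_trichotomy t 0 with h | h | h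
      · simp [h]
      · simp [h]
      · simp [h, h.not_gt]
    rw [this]
    exact Measurable.ite measurableSet_Iio measurable_const
      (Measurable.ite measurableSet_Ioi measurable_const measurable_const)
  have hwm : Measurable w := hsm.mul (hv.comp continuous_abs.measurable)
  have hwC : ∀ t, |w t| ≤ C := by
    intro t
    have h1 := hC |t| (abs_nonneg t)
    have h2 := (abs_nonneg _).trans h1
    rcases lt_trichotomy t 0 with h | h | h
    · simpa [hw, h] using h1
    · simpa [hw, h] using h2
    · simpa [hw, h] using h1
  have hl := locallyIntegrable_of_bounded hwm hwC
  have key := memH1Loc_of_bounded (u := fun t => u |t|) hwm hwC (fun t => by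
    have := integral_eq_of_hasDerivAt_off_countable (fun t => u |t|) w (a := 0) (b := t)
      -- The even extension may fail to be differentiable at the origin, on `S` and on its
      -- reflection.
      (s := {0} ∪ S ∪ (Neg.neg ⁻¹' S))
      (((countable_singleton 0).union hS).union (hS.preimage neg_injective))
      (hu.comp continuous_abs).continuousOn
      (fun x hx => by
        have hx2 := hx.2
        simp only [mem_union, mem_singleton_iff, mem_preimage, not_or] at hx2
        obtain ⟨⟨hx0, hxS⟩, hxS'⟩ := hx2
        rcases lt_or_gt_of_ne hx0 with h | h
        · have h1 := hd (-x) (by linarith) hxS'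
          have h2 := h1.comp x (hasDerivAt_neg x)
          have h3 : HasDerivAt (fun t => u |t|) (v (-x) * -1) x := by
            refine h2.congr_of_eventuallyEq ?_
            filter_upwards [Iio_mem_nhds h] with y hy
            simp [abs_of_neg (mem_Iio.1 hy)]
          convert! h3 using 1
          simp [hw, h, abs_of_neg h]
        · have h1 := hd x h hxS
          have h3 : HasDerivAt (fun t => u |t|) (v x) x := by
            refine h1.congr_of_eventuallyEq ?_
            filter_upwards [Ioi_mem_nhds h] with y hy
            simp [abs_of_pos (mem_Ioi.1 hy)]
          convert! h3 using 1
          simp [hw, h, abs_of_pos h])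
      ((hl.integrableOn_isCompact isCompact_uIcc).intervalIntegrable)
    rw [this]
    ring)
  refine ⟨key.1, ?_⟩
  have : ∀ᵐ t : ℝ, t ≠ 0 := by simp [ae_iff]
  filter_upwards [key.2, this] with t ht ht0
  rw [ht, hw]
  rcases lt_or_gt_of_ne ht0 with h | h <;> simp [h]

/-- Assembling an admissible pair from its restrictions to the half line. -/
lemma exists_admissible_of_half {f u v a : ℝ → ℝ} {S : Set ℝ} {C A s : ℝ} (hu : Continuous u)
    (hv : Measurable v) (hC : ∀ t, 0 ≤ t → |v t| ≤ C) (hS : S.Countable)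
    (hd : ∀ t, 0 < t → t ∉ S → HasDerivAt u (v t) t) (hu01 : ∀ t, 0 ≤ t → 0 ≤ u t ∧ u t ≤ 1)
    (hlim : Tendsto u atTop (𝓝 1)) (ha : Measurable a) (hA : ∀ t, 0 ≤ t → |a t| ≤ A)
    (hai : IntegrableOn a (Ioi 0)) (has : 2 * ∫ t in Ioi 0, a t = s) (hs : 0 ≤ s) :
    ∃ p ∈ admissible s, energy f p = 2 * ∫⁻ t in Ioi (0 : ℝ),
      (coeff f (u t) * ENNReal.ofReal (a t ^ 2) + ENNReal.ofReal ((1 - u t) ^ 2 / 4)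
        + ENNReal.ofReal (v t ^ 2)) := by
  obtain ⟨hβ, hβd⟩ := memH1Loc_comp_abs hu hv hC hS hd
  set α : ℝ → ℝ := fun t => ∫ x in (0 : ℝ)..t, a |x| with hα
  obtain ⟨hαm, hαd⟩ := memH1Loc_of_bounded (u := α) (v := fun t => a |t|)
    (ha.comp continuous_abs.measurable) (C := A) (fun t => hA _ (abs_nonneg t))
    (by intro t; simp [hα])
  refine ⟨(α, fun t => u |t|), ⟨hαm, hβ, ?_, ?_, fun t => hu01 _ (abs_nonneg t), ?_⟩, ?_⟩
  · exact (integrable_comp_abs ha hai).congr hαd.symm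
  · rw [integral_congr_ae hαd, integral_comp_abs, has, abs_of_nonneg hs]
  · have := hlim.comp (tendsto_norm_cocompact_atTop (E := ℝ))
    simpa [Function.comp_def] using this
  · rw [← lintegral_comp_abs fun t => coeff f (u t) * ENNReal.ofReal (a t ^ 2) +
      ENNReal.ofReal ((1 - u t) ^ 2 / 4) + ENNReal.ofReal (v t ^ 2)]
    refine lintegral_congr_ae ?_
    filter_upwards [hαd, hβd] with t h1 h2
    simp only [h1, h2]

/-! ### The autonomous equation of the profile -/

/-- Solution of the autonomous equation `R' = ρ(R)`, `R(0) = 0`, `R > 0` on `(0, ∞)`, for a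
function `ρ ≤ 1`, positive on `(0, ∞)`, with locally integrable reciprocal. -/
lemma exists_flow {ρ : ℝ → ℝ} (hρ : Continuous ρ) (hpos : ∀ x, 0 < x → 0 < ρ x)
    (hle : ∀ x, ρ x ≤ 1) (hint : ∀ A, 0 < A → IntervalIntegrable (fun x => (ρ x)⁻¹) volume 0 A) :
    ∃ R : ℝ → ℝ, Continuous R ∧ R 0 = 0 ∧ (∀ t, 0 < t → 0 < R t) ∧
      (∀ t, 0 < t → HasDerivAt R (ρ (R t)) t) ∧ Tendsto R atTop atTop := by
  -- Separation of variables: `R` is the inverse of the travel time `τ`, the primitive of `g`. The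
  -- value `1` on `x ≤ 0` makes `g ≥ 1` everywhere, so `τ` is an increasing bijection of `ℝ`.
  set g : ℝ → ℝ := fun x => if x ≤ 0 then 1 else (ρ x)⁻¹ with hg
  have hg1 : ∀ x, 1 ≤ g x := by
    intro x
    simp only [hg]
    split_ifs with h
    · exact le_rfl
    · exact one_le_inv_iff₀.2 ⟨hpos x (not_le.1 h), hle x⟩
  have hi0 : ∀ x, IntervalIntegrable g volume 0 x := by
    intro x
    rcases le_or_gt x 0 with h | h
    · refine (intervalIntegrable_const (c := (1 : ℝ))).congr fun y hy => ?_
      rw [uIoc_of_ge h] at hy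
      simp [hg, hy.2]
    · refine (hint x h).congr fun y hy => ?_
      rw [uIoc_of_le h.le] at hy
      simp [hg, hy.1.not_ge]
  have hi : ∀ x y, IntervalIntegrable g volume x y := fun x y => (hi0 x).symm.trans (hi0 y)
  set τ : ℝ → ℝ := fun x => ∫ y in (0 : ℝ)..x, g y with hτ
  have hsub : ∀ x y, x ≤ y → y - x ≤ τ y - τ x := by
    intro x y h
    rw [hτ]
    simp only
    rw [intervalIntegral.integral_interval_sub_left (hi 0 y) (hi 0 x)]
    have := intervalIntegral.integral_mono_on h intervalIntegrable_const (hi x y)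
      (fun z _ => hg1 z)
    simpa using this
  have hmono : StrictMono τ := fun x y h => by
    have := hsub x y h.le
    linarith
  have hτ0 : τ 0 = 0 := by simp [hτ]
  have hcont : Continuous τ := intervalIntegral.continuous_primitive hi 0
  have hsurj : Function.Surjective τ := by
    apply hcont.surjective
    · refine tendsto_atTop_mono' _ ?_ tendsto_id
      filter_upwards [eventually_ge_atTop 0] with x hx
      have := hsub 0 x hx
      simp only [id]
      linarith
    · refine tendsto_atBot_mono' _ ?_ tendsto_id
      filter_upwards [eventually_le_atBot 0] with x hx
      have := hsub x 0 hx
      simp only [id]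
      linarith
  let e := hmono.orderIsoOfSurjective τ hsurj
  have he : ∀ x, τ (e.symm x) = x := fun x => e.apply_symm_apply x
  have he' : ∀ x, e.symm (τ x) = x := fun x => e.symm_apply_apply x
  have hR0 : e.symm 0 = 0 := by rw [← hτ0, he', hτ0]
  have hRpos : ∀ t, 0 < t → 0 < e.symm t := fun t ht => by
    have := e.symm.strictMono ht
    rwa [hR0] at this
  refine ⟨e.symm, e.symm.continuous, hR0, hRpos, fun t ht => ?_, e.symm.tendsto_atTop⟩
  have hx := hRpos t ht
  set x := e.symm t with hxdef
  have hgx : g x = (ρ x)⁻¹ := by simp [hg, hx.not_ge]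
  have hρx := hpos x hx
  have hge : g =ᶠ[𝓝 x] fun y => (ρ y)⁻¹ := by
    filter_upwards [Ioi_mem_nhds hx] with y hy
    simp [hg, (mem_Ioi.1 hy).not_ge]
  have hgc : ContinuousAt g x := (hρ.continuousAt.inv₀ hρx.ne').congr hge.symm
  have hgm : StronglyMeasurableAtFilter g (𝓝 x) := by
    refine ⟨Ioi 0, Ioi_mem_nhds hx, ?_⟩
    have : AEStronglyMeasurable (fun y => (ρ y)⁻¹) (volume.restrict (Ioi 0)) :=
      hρ.measurable.inv.aestronglyMeasurable
    refine this.congr ?_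
    filter_upwards [ae_restrict_mem measurableSet_Ioi] with y hy
    simp [hg, (mem_Ioi.1 hy).not_ge]
  have hd : HasDerivAt τ (g x) x := intervalIntegral.integral_hasDerivAt_right (hi 0 x) hgm hgc
  have := HasDerivAt.of_local_left_inverse (g := e.symm) (a := t)
    e.symm.continuous.continuousAt hd (by rw [hgx]; exact inv_ne_zero hρx.ne')
    (Eventually.of_forall he)
  rwa [hgx, inv_inv] at this

lemma intervalIntegrable_inv_of_sqrt_le {φ : ℝ → ℝ} (hφ : Measurable φ) {κ A : ℝ} (hκ : 0 < κ)
    (hA : 0 ≤ A) (h : ∀ x ∈ Ioc 0 A, κ * √x ≤ φ x) :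
    IntervalIntegrable (fun x => (φ x)⁻¹) volume 0 A := by
  have h1 : IntervalIntegrable (fun x : ℝ => κ⁻¹ * x ^ (-(1 / 2) : ℝ)) volume 0 A :=
    (intervalIntegral.intervalIntegrable_rpow' (by norm_num)).const_mul _
  refine h1.mono_fun hφ.inv.aestronglyMeasurable ?_
  filter_upwards [ae_restrict_mem measurableSet_uIoc] with x hx
  rw [uIoc_of_le hA] at hx
  have hs : 0 < √x := Real.sqrt_pos.2 hx.1
  have h2 := h x hx
  have h3 : 0 < κ * √x := mul_pos hκ hs
  rw [Real.norm_of_nonneg (inv_nonneg.2 (h3.le.trans h2)), Real.rpow_neg hx.1.le,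
    ← Real.sqrt_eq_rpow, ← mul_inv, Real.norm_of_nonneg (inv_nonneg.2 h3.le)]
  exact inv_anti₀ h3 h2

/-- Solution of `y' = -y q(y)`, `y(0) = W`, decreasing from `W` to `0`. -/
lemma exists_profile {q : ℝ → ℝ} {W κ : ℝ} (hq : Continuous q) (hW : 0 < W) (hκ : 0 < κ)
    (hle : ∀ x, q x ≤ 1) (hge : ∀ x ∈ Icc 0 W, κ * √(W - x) ≤ q x) :
    ∃ y : ℝ → ℝ, Continuous y ∧ y 0 = W ∧ (∀ t, 0 < t → y t ∈ Ioo 0 W) ∧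
      (∀ t, 0 < t → HasDerivAt y (-(y t * q (y t))) t) ∧ Tendsto y atTop (𝓝 0) := by
  have hmem : ∀ x : ℝ, 0 < x → W * Real.exp (-x) ∈ Ioo 0 W := fun x hx =>
    ⟨by positivity, mul_lt_of_lt_one_right hW (by simpa using hx)⟩
  -- With `y = W exp(-R)` the equation becomes `R' = q (W exp(-R))`. Even if `q W = 0` makes the
  -- start an equilibrium, the square-root lower bound keeps the travel time finite, so a solution
  -- can leave it.
  obtain ⟨R, hR, hR0, hRpos, hRd, hRt⟩ := exists_flow (ρ := fun x => q (W * Real.exp (-x)))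
    (hq.comp (by fun_prop))
    (fun x hx => by
      have h := hmem x hx
      exact (mul_pos hκ (Real.sqrt_pos.2 (by linarith [h.2]))).trans_le (hge _ ⟨h.1.le, h.2.le⟩))
    (fun x => hle _)
    (fun A hA => by
      -- The constant comes from `1 - exp(-x) ≥ x exp(-x) ≥ x exp(-A)` for `0 < x ≤ A`.
      have hk : 0 < κ * √(W * Real.exp (-A)) := by positivity
      refine intervalIntegrable_inv_of_sqrt_le (hq.comp (by fun_prop)).measurable hk hA.le ?_
      intro x hx
      have h := hmem x hx.1
      refine le_trans ?_ (hge _ ⟨h.1.le, h.2.le⟩)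
      rw [mul_assoc, ← Real.sqrt_mul (by positivity)]
      refine mul_le_mul_of_nonneg_left (Real.sqrt_le_sqrt ?_) hκ.le
      have e1 : Real.exp (-A) ≤ Real.exp (-x) := Real.exp_le_exp.2 (by linarith [hx.2])
      have e2 := Real.add_one_le_exp x
      have e3 : Real.exp x * Real.exp (-x) = 1 := by rw [← Real.exp_add]; simp
      have e4 : x * Real.exp (-x) ≤ 1 - Real.exp (-x) := by
        nlinarith [Real.exp_pos (-x)]
      have e5 : Real.exp (-A) * x ≤ 1 - Real.exp (-x) := by nlinarith [hx.1]
      nlinarith)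
  refine ⟨fun t => W * Real.exp (-R t), by fun_prop, by simp [hR0], fun t ht => hmem _ (hRpos t ht),
    fun t ht => ?_, ?_⟩
  · have := ((hRd t ht).neg.exp).const_mul W
    convert! this using 1
    simp only [Pi.neg_apply]
    ring
  · have := (Real.tendsto_exp_neg_atTop_nhds_zero.comp hRt).const_mul W
    simpa [Function.comp_def] using this

/-! ### The cofactor near the turning point -/

/-- Convexity on `[x, 1]` together with `H(1) = 0`: the slope `H(w)/(1 - w)` is nonincreasing. -/
lemma stressSq_mul_le (hf : Assumptions f σ) {x w : ℝ} (hx : 0 ≤ x) (hxw : x ≤ w) (hw : w < 1) :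
    stressSq f σ w * (1 - x) ≤ (1 - w) * stressSq f σ x := by
  have h1 : 0 < 1 - x := by linarith
  have ha : 0 ≤ (1 - w) / (1 - x) := div_nonneg (by linarith) h1.le
  have hb : 0 ≤ (w - x) / (1 - x) := div_nonneg (by linarith) h1.le
  have hx1 : x ∈ Icc (0 : ℝ) 1 := ⟨hx, by linarith⟩
  have h := (convexOn_stressSq hf).2 hx1 (right_mem_Icc.2 zero_le_one) ha hb
    (by field_simp; ring)
  have e : ((1 - w) / (1 - x)) • x + ((w - x) / (1 - x)) • (1 : ℝ) = w := by
    simp only [smul_eq_mul]; field_simp; ring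
  rw [e, stressSq_one hf] at h
  simp only [smul_eq_mul, mul_zero, add_zero] at h
  rw [div_mul_eq_mul_div, le_div_iff₀ h1] at h
  exact h

/-- With `W` the width at `c`, `stressSq_mul_le` gives `c/H(x) ≤ (1 - W)/(1 - x) ≤ 1 - (W - x)`, and
`1 - k² ≥ 1 - k` on `[0,1]`. This makes the reciprocal of the cofactor integrable up to `W`. -/
lemma sqrt_le_cofactor (hf : Assumptions f σ) {c x : ℝ} (hc : c ∈ Ioo 0 σ)
    (hx : x ∈ Icc 0 (width f σ c)) : √(width f σ c - x) ≤ cofactor f σ c x := by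
  set W := width f σ c with hW
  have hW1 : W < 1 := width_lt_one hf hc.1 hc.2.le
  have hHW : stressSq f σ W = c := stressSq_width hf ⟨hc.1.le, hc.2.le⟩
  have h := stressSq_mul_le hf hx.1 hx.2 hW1
  have hcH : c ≤ stressSq f σ x := hHW ▸ antitone_stressSq hf hx.2
  rw [hHW] at h
  have hH : 0 < stressSq f σ x := hc.1.trans_le hcH
  rw [cofactor_eq hcH]
  apply Real.sqrt_le_sqrt
  have hk1 : c / stressSq f σ x ≤ 1 := (div_le_one hH).2 hcH
  have hk0 : 0 ≤ c / stressSq f σ x := div_nonneg hc.1.le hH.le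
  have hk : c / stressSq f σ x ≤ 1 - (W - x) := by
    rw [div_le_iff₀ hH]
    have h1x : 0 < 1 - x := by linarith [hx.2]
    have : (1 - W) * stressSq f σ x ≤ (1 - (W - x)) * (1 - x) * stressSq f σ x :=
      mul_le_mul_of_nonneg_right (by nlinarith [hx.1, hx.2]) hH.le
    nlinarith
  nlinarith

lemma cofactor_pos (hf : Assumptions f σ) {c x : ℝ} (hc : c ∈ Ioo 0 σ)
    (hx : x ∈ Ico 0 (width f σ c)) : 0 < cofactor f σ c x :=
  (Real.sqrt_pos.2 (by linarith [hx.2])).trans_le (sqrt_le_cofactor hf hc ⟨hx.1, hx.2.le⟩)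

lemma intervalIntegrable_inv_cofactor (hf : Assumptions f σ) {c : ℝ} (hc : c ∈ Ioo 0 σ) :
    IntervalIntegrable (fun w => (cofactor f σ c w)⁻¹) volume 0 (width f σ c) := by
  have hm := width_mem hf hc.1.le
  have := intervalIntegrable_inv_of_sqrt_le (φ := fun x => cofactor f σ c (width f σ c - x))
    ((measurable_cofactor hf c).comp (by fun_prop)) one_pos hm.1 (fun x hx => by
      have := sqrt_le_cofactor hf hc (x := width f σ c - x) ⟨by linarith [hx.2], by linarith [hx.1]⟩
      simpa using this)
  have h2 := this.comp_sub_left (width f σ c)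
  simp only [sub_sub_cancel, sub_zero, sub_self] at h2
  exact h2.symm

/-! ### The opening of the optimal profile -/

/-- Density of the opening of the optimal profile with respect to `w = (1 - β)²`. -/
def openingDensity (f : ℝ → ℝ) (σ c w : ℝ) : ℝ :=
  c / (stressSq f σ w ^ 2 * cofactor f σ c w)

/-- The opening of the optimal profile with stress `c`. -/
def opening (f : ℝ → ℝ) (σ c : ℝ) : ℝ := ∫ w in (0 : ℝ)..width f σ c, openingDensity f σ c w

lemma openingDensity_nonneg {c : ℝ} (hc : 0 ≤ c) (w : ℝ) : 0 ≤ openingDensity f σ c w :=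
  div_nonneg hc (mul_nonneg (sq_nonneg _) (cofactor_nonneg _ _))

lemma le_stressSq_of_le_width (hf : Assumptions f σ) {c : ℝ} (hc : c ∈ Ioo 0 σ) {w : ℝ}
    (hw : w ≤ width f σ c) : c ≤ stressSq f σ w := by
  have := antitone_stressSq hf hw
  rwa [stressSq_width hf ⟨hc.1.le, hc.2.le⟩] at this

lemma intervalIntegrable_openingDensity (hf : Assumptions f σ) {c : ℝ} (hc : c ∈ Ioo 0 σ) :
    IntervalIntegrable (openingDensity f σ c) volume 0 (width f σ c) := by
  have hm := width_mem hf hc.1.le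
  refine ((intervalIntegrable_inv_cofactor hf hc).const_mul c⁻¹).mono_fun ?_ ?_
  · have h1 := (continuous_stressSq hf).measurable
    have h2 := measurable_cofactor hf c
    exact (measurable_const.div ((h1.pow_const 2).mul h2)).aestronglyMeasurable
  · filter_upwards [ae_restrict_mem measurableSet_uIoc] with w hw
    rw [uIoc_of_le hm.1] at hw
    have hcH := le_stressSq_of_le_width hf hc hw.2
    have hc0 := hc.1
    have hq := inv_nonneg.2 (cofactor_nonneg (f := f) (σ := σ) c w)
    rw [Real.norm_of_nonneg (openingDensity_nonneg hc0.le w),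
      Real.norm_of_nonneg (mul_nonneg (inv_nonneg.2 hc0.le) hq), openingDensity, div_mul_eq_div_div,
      div_eq_mul_inv _ (cofactor f σ c w)]
    refine mul_le_mul_of_nonneg_right ?_ hq
    rw [div_le_iff₀ (by nlinarith), ← div_eq_inv_mul, le_div_iff₀ hc0]
    nlinarith

lemma opening_nonneg (hf : Assumptions f σ) {c : ℝ} (hc : 0 ≤ c) : 0 ≤ opening f σ c :=
  intervalIntegral.integral_nonneg (width_mem hf hc).1 fun w _ => openingDensity_nonneg hc w

/-- The concave function `d ↦ √(1 - (d/h)²)` lies below its tangent at `c`; this is the side `d ≥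
c`, and `sqrt_one_sub_le_add` is the other. The slope is minus the opening density. -/
lemma sqrt_one_sub_sub_le {h c d : ℝ} (hc : 0 < c) (hcd : c ≤ d) (hdh : d ≤ h)
    (hA : 0 < √(1 - (c / h) ^ 2)) :
    √(1 - (d / h) ^ 2) + (d - c) * (c / (h ^ 2 * √(1 - (c / h) ^ 2))) ≤ √(1 - (c / h) ^ 2) := by
  have hh : 0 < h := by linarith
  have hd1 : d / h ≤ 1 := (div_le_one hh).2 hdh
  have hd0 : 0 ≤ d / h := div_nonneg (by linarith) hh.le
  have eA := Real.sq_sqrt (Real.sqrt_pos.1 hA).le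
  have eB := Real.sq_sqrt (show 0 ≤ 1 - (d / h) ^ 2 by nlinarith)
  set A := √(1 - (c / h) ^ 2)
  set B := √(1 - (d / h) ^ 2)
  have e : (d - c) * (c / (h ^ 2 * A)) = (d - c) * c / h ^ 2 / A := by field_simp
  rw [e, ← le_sub_iff_add_le', div_le_iff₀ hA]
  have e1 : (d - c) * c / h ^ 2 = (d / h - c / h) * (c / h) := by field_simp
  rw [e1]
  have hcd' : c / h ≤ d / h := div_le_div_of_nonneg_right hcd hh.le
  nlinarith [sq_nonneg (A - B), sq_nonneg (d / h - c / h)]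

lemma sqrt_one_sub_le_add {h c d : ℝ} (hh : 0 < h) (hd : 0 ≤ d) (hdc : d ≤ c) (hch : c ≤ h)
    (hA : 0 < √(1 - (c / h) ^ 2)) :
    √(1 - (d / h) ^ 2) ≤ √(1 - (c / h) ^ 2) + (c - d) * (c / (h ^ 2 * √(1 - (c / h) ^ 2))) := by
  have hd1 : d / h ≤ 1 := (div_le_one hh).2 (by linarith)
  have hd0 : 0 ≤ d / h := div_nonneg hd hh.le
  have eA := Real.sq_sqrt (Real.sqrt_pos.1 hA).le
  have eB := Real.sq_sqrt (show 0 ≤ 1 - (d / h) ^ 2 by nlinarith)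
  set A := √(1 - (c / h) ^ 2)
  set B := √(1 - (d / h) ^ 2)
  have e : (c - d) * (c / (h ^ 2 * A)) = (c - d) * c / h ^ 2 / A := by field_simp
  rw [e, ← sub_le_iff_le_add', le_div_iff₀ hA]
  have e1 : (c - d) * c / h ^ 2 = (c / h - d / h) * (c / h) := by field_simp
  rw [e1]
  have hcd' : d / h ≤ c / h := div_le_div_of_nonneg_right hdc hh.le
  nlinarith [sq_nonneg (A - B), sq_nonneg (d / h - c / h)]

lemma legendre_stressSq (hf : Assumptions f σ) {w : ℝ} (hw : w ∈ Icc (0 : ℝ) 1) :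
    legendre f σ (stressSq f σ w) = ∫ x in (0 : ℝ)..w, cofactor f σ (stressSq f σ w) x := by
  rw [legendre_eq_integral_width hf ⟨stressSq_nonneg hf w, stressSq_le hf w⟩, width_stressSq hf hw]

lemma cofactor_le (hf : Assumptions f σ) {c w : ℝ} (hc : c ∈ Ioo 0 σ) (hw : w ∈ Ioo 0 (width f σ c))
    {d : ℝ} (hd : d ∈ Icc 0 c) :
    cofactor f σ d w ≤ cofactor f σ c w + (c - d) * openingDensity f σ c w := by
  have hcH := le_stressSq_of_le_width hf hc hw.2.le
  have hp := cofactor_pos hf hc ⟨hw.1.le, hw.2⟩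
  rw [openingDensity]
  rw [cofactor_eq hcH] at hp ⊢
  rw [cofactor_eq (hd.2.trans hcH)]
  exact sqrt_one_sub_le_add (hc.1.trans_le hcH) hd.1 hd.2 hcH hp

/-- If `c ∈ (0, σ)` minimizes `c ↦ c s + Φ(c)`, then the optimal profile with stress `c` has
opening `s`. -/
lemma opening_eq (hf : Assumptions f σ) {c s : ℝ} (hc : c ∈ Ioo 0 σ)
    (hmin : ∀ x ∈ Icc 0 σ, c * s + legendre f σ c ≤ x * s + legendre f σ x) :
    opening f σ c = s := by
  set W := width f σ c with hW
  have hcI : c ∈ Icc 0 σ := ⟨hc.1.le, hc.2.le⟩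
  have hW0 : 0 < W := width_pos hf hc.1.le hc.2
  have hW1 : W < 1 := width_lt_one hf hc.1 hc.2.le
  have hHW : stressSq f σ W = c := stressSq_width hf hcI
  have hD := intervalIntegrable_openingDensity hf hc
  have hHI : ∀ w, stressSq f σ w ∈ Icc 0 σ := fun w => ⟨stressSq_nonneg hf w, stressSq_le hf w⟩
  have hq := fun d a b => intervalIntegrable_cofactor hf d a b
  apply le_antisymm
  -- Compare `c` with the larger stress `d = H(w)`, `w < W`. The tangent inequality is valid on `[0,
  -- w]`, where `d ≤ H`, and `w → W⁻` recovers the whole opening.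
  · have hcont : ContinuousOn (fun w => ∫ x in (0 : ℝ)..w, openingDensity f σ c x) (Icc 0 W) := by
      have := intervalIntegral.continuousOn_primitive_interval' hD (left_mem_uIcc)
      rwa [uIcc_of_le hW0.le] at this
    have ht : Tendsto (fun w => ∫ x in (0 : ℝ)..w, openingDensity f σ c x) (𝓝[<] W)
        (𝓝 (opening f σ c)) :=
      (hcont W (right_mem_Icc.2 hW0.le)).mono_left (by
        rw [← nhdsWithin_Ioo_eq_nhdsLT hW0]
        exact nhdsWithin_mono _ Ioo_subset_Icc_self)
    refine le_of_tendsto ht ?_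
    filter_upwards [Ioo_mem_nhdsLT hW0] with w hw
    have hw01 : w ∈ Icc (0 : ℝ) 1 := ⟨hw.1.le, hw.2.le.trans hW1.le⟩
    set d := stressSq f σ w with hd
    have hcd : c < d := hHW ▸ strictAntiOn_stressSq hf hw01 ⟨hW0.le, hW1.le⟩ hw.2
    have hDw : IntervalIntegrable (openingDensity f σ c) volume 0 w :=
      hD.mono_set (by
        rw [uIcc_of_le hw.1.le, uIcc_of_le hW0.le]
        exact Icc_subset_Icc_right hw.2.le)
    have h1 : (∫ x in (0 : ℝ)..w, cofactor f σ d x) +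
        (d - c) * ∫ x in (0 : ℝ)..w, openingDensity f σ c x ≤
        ∫ x in (0 : ℝ)..w, cofactor f σ c x := by
      rw [← intervalIntegral.integral_const_mul, ← intervalIntegral.integral_add (hq d 0 w)
        (hDw.const_mul _)]
      refine intervalIntegral.integral_mono_on hw.1.le ((hq d 0 w).add (hDw.const_mul _))
        (hq c 0 w) fun x hx => ?_
      have hdH : d ≤ stressSq f σ x := antitone_stressSq hf hx.2
      have hp := cofactor_pos hf hc ⟨hx.1, hx.2.trans_lt hw.2⟩
      rw [openingDensity]
      rw [cofactor_eq (hcd.le.trans hdH)] at hp ⊢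
      rw [cofactor_eq hdH]
      exact sqrt_one_sub_sub_le hc.1 hcd.le hdH hp
    have h2 : ∫ x in (0 : ℝ)..w, cofactor f σ c x ≤ legendre f σ c :=
      intervalIntegral.integral_mono_interval le_rfl hw.1.le hw01.2
        (Eventually.of_forall fun x => cofactor_nonneg c x) (hq c 0 1)
    have h3 := hmin d (hHI w)
    rw [hd, legendre_stressSq hf hw01, ← hd] at h3
    have h4 : (d - c) * ∫ x in (0 : ℝ)..w, openingDensity f σ c x ≤ (d - c) * s := by linarith
    exact le_of_mul_le_mul_left h4 (by linarith)
  -- Now `w > W`, so `d = H(w) < c` and `Φ(d)` has an extra piece over `[W, w]`. Convexity gives `w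
  -- - W ≤ (c - d)/d`, so the piece is at most `(c - d) √(1 - (d/c)²)/d`, which is `o(c - d)`.
  · have ht : Tendsto (fun w => opening f σ c +
        √(1 - (stressSq f σ w / c) ^ 2) / stressSq f σ w) (𝓝[>] W) (𝓝 (opening f σ c)) := by
      have hcont : ContinuousAt (fun w => opening f σ c +
          √(1 - (stressSq f σ w / c) ^ 2) / stressSq f σ w) W := by
        have h := (continuous_stressSq hf).continuousAt (x := W)
        exact continuousAt_const.add ((continuousAt_const.sub
          ((h.div_const c).pow 2)).sqrt.div h (by rw [hHW]; exact hc.1.ne'))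
      have h := hcont.tendsto
      rw [hHW, div_self hc.1.ne'] at h
      simp only [one_pow, sub_self, Real.sqrt_zero, zero_div, add_zero] at h
      exact h.mono_left nhdsWithin_le_nhds
    refine ge_of_tendsto ht ?_
    filter_upwards [Ioo_mem_nhdsGT hW1] with w hw
    have hw01 : w ∈ Icc (0 : ℝ) 1 := ⟨hW0.le.trans hw.1.le, hw.2.le⟩
    have h3 := hmin _ (hHI w)
    rw [legendre_stressSq hf hw01] at h3
    have hchord := stressSq_mul_le hf hW0.le hw.1.le hw.2
    rw [hHW] at hchord
    have hdpos : 0 < stressSq f σ w := stressSq_pos hf hw.2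
    have hdc : stressSq f σ w < c := hHW ▸ strictAntiOn_stressSq hf ⟨hW0.le, hW1.le⟩ hw01 hw.1
    set d := stressSq f σ w with hd
    rw [← intervalIntegral.integral_add_adjacent_intervals (hq d 0 W) (hq d W w)] at h3
    have h1 : ∫ x in (0 : ℝ)..W, cofactor f σ d x ≤ legendre f σ c + (c - d) * opening f σ c := by
      rw [legendre_eq_integral_width hf hcI, opening, ← intervalIntegral.integral_const_mul,
        ← intervalIntegral.integral_add (hq c 0 W) (hD.const_mul _)]
      exact intervalIntegral.integral_mono_on_of_le_Ioo hW0.le (hq d 0 W)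
        ((hq c 0 W).add (hD.const_mul _)) fun x hx => cofactor_le hf hc hx ⟨hdpos.le, hdc.le⟩
    have h2 : ∫ x in W..w, cofactor f σ d x ≤ (w - W) * √(1 - (d / c) ^ 2) := by
      have : ∫ x in W..w, √(1 - (d / c) ^ 2) = (w - W) * √(1 - (d / c) ^ 2) := by simp
      rw [← this]
      refine intervalIntegral.integral_mono_on hw.1.le (hq d W w) intervalIntegrable_const
        fun x hx => ?_
      have hx1 : stressSq f σ x ≤ c := hHW ▸ antitone_stressSq hf hx.1
      have hx2 : 0 < max (stressSq f σ x) d := hdpos.trans_le (le_max_right _ _)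
      have hx3 : max (stressSq f σ x) d ≤ c := max_le hx1 hdc.le
      unfold cofactor
      gcongr
      exact div_nonneg hdpos.le hc.1.le
    have h5 : d * (w - W) ≤ c - d := by nlinarith [hw.2, hw.1]
    have hr := Real.sqrt_nonneg (1 - (d / c) ^ 2)
    have h6 : (w - W) * √(1 - (d / c) ^ 2) ≤ (c - d) * (√(1 - (d / c) ^ 2) / d) := by
      rw [← mul_div_assoc, le_div_iff₀ hdpos]
      nlinarith
    have h7 : (c - d) * s ≤ (c - d) * (opening f σ c + √(1 - (d / c) ^ 2) / d) := by linarith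
    exact le_of_mul_le_mul_left h7 (by linarith)

/-- Pointwise, `1/q = c · c/(H² q) + q`, since `q² + (c/H)² = 1`. The left side is the energy of the
optimal pair after the change of variables `w = y(t)`. -/
lemma integral_inv_cofactor (hf : Assumptions f σ) {c : ℝ} (hc : c ∈ Ioo 0 σ) :
    ∫ w in (0 : ℝ)..width f σ c, (cofactor f σ c w)⁻¹ =
      c * opening f σ c + legendre f σ c := by
  have hm := width_mem hf hc.1.le
  rw [legendre_eq_integral_width hf ⟨hc.1.le, hc.2.le⟩, opening,
    ← intervalIntegral.integral_const_mul, ← intervalIntegral.integral_add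
      ((intervalIntegrable_openingDensity hf hc).const_mul c) (intervalIntegrable_cofactor hf c _ _)]
  rw [intervalIntegral.integral_of_le hm.1, intervalIntegral.integral_of_le hm.1,
    integral_Ioc_eq_integral_Ioo, integral_Ioc_eq_integral_Ioo]
  refine setIntegral_congr_fun measurableSet_Ioo fun w hw => ?_
  have hcH := le_stressSq_of_le_width hf hc hw.2.le
  have hp := cofactor_pos hf hc ⟨hw.1.le, hw.2⟩
  have hH := hc.1.trans_le hcH
  have hsq : cofactor f σ c w ^ 2 = 1 - (c / stressSq f σ w) ^ 2 := by
    rw [cofactor_eq hcH] at hp ⊢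
    exact Real.sq_sqrt (Real.sqrt_pos.1 hp).le
  simp only [openingDensity]
  rw [div_pow] at hsq
  field_simp at hsq ⊢
  linarith

/-! ### Optimal pairs and competitors -/

/-- The optimal pair with stress `c`. -/
lemma exists_pair (hf : Assumptions f σ) {c : ℝ} (hc : c ∈ Ioo 0 σ) :
    ∃ p ∈ admissible (opening f σ c),
      energy f p = ENNReal.ofReal (c * opening f σ c + legendre f σ c) := by
  set W := width f σ c with hW
  have hW0 : 0 < W := width_pos hf hc.1.le hc.2
  have hW1 : W < 1 := width_lt_one hf hc.1 hc.2.le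
  have hqc := continuous_cofactor hf hc.1.le
  have hHc := continuous_stressSq hf
  obtain ⟨y, hyc, hy0, hym, hyd, hyt⟩ := exists_profile hqc hW0 one_pos
    (fun x => cofactor_le_one c x) (fun x hx => by
      rw [one_mul]; exact sqrt_le_cofactor hf hc hx)
  have hym' : ∀ t, 0 ≤ t → 0 < y t ∧ y t ≤ W := by
    intro t ht
    rcases ht.eq_or_lt with rfl | ht
    · rw [hy0]; exact ⟨hW0, le_rfl⟩
    · exact ⟨(hym t ht).1, (hym t ht).2.le⟩
  have hqpos : ∀ t, 0 < t → 0 < cofactor f σ c (y t) := fun t ht =>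
    cofactor_pos hf hc ⟨(hym t ht).1.le, (hym t ht).2⟩
  have hanti : StrictAntiOn y (Ioi 0) := by
    apply strictAntiOn_of_deriv_neg (convex_Ioi 0) hyc.continuousOn
    intro t ht
    rw [interior_Ioi] at ht
    rw [(hyd t ht).deriv]
    have := mul_pos (hym t ht).1 (hqpos t ht)
    linarith
  have himg : y '' Ioi 0 = Ioo 0 W := by
    ext w
    constructor
    · rintro ⟨t, ht, rfl⟩
      exact hym t ht
    · intro hw
      obtain ⟨T, hT0, hT⟩ := ((eventually_ge_atTop 0).and
        (hyt.eventually (gt_mem_nhds hw.1))).exists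
      obtain ⟨t, ht, rfl⟩ := intermediate_value_Icc' hT0 hyc.continuousOn
        (show w ∈ Icc (y T) (y 0) from ⟨hT.le, by rw [hy0]; exact hw.2.le⟩)
      refine ⟨t, lt_of_le_of_ne ht.1 ?_, rfl⟩
      rintro rfl
      rw [hy0] at hw
      exact lt_irrefl _ hw.2
  have hyd' : ∀ t ∈ Ioi (0 : ℝ), HasDerivWithinAt y (-(y t * cofactor f σ c (y t))) (Ioi 0) t :=
    fun t ht => (hyd t ht).hasDerivWithinAt
  have habs : ∀ t ∈ Ioi (0 : ℝ), |-(y t * cofactor f σ c (y t))| = y t * cofactor f σ c (y t) :=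
    fun t ht => by rw [abs_neg, abs_of_pos (mul_pos (hym t ht).1 (hqpos t ht))]
  have hHy : ∀ t, 0 ≤ t → c ≤ stressSq f σ (y t) := fun t ht =>
    le_stressSq_of_le_width hf hc (hym' t ht).2
  set a : ℝ → ℝ := fun t => c * y t / (2 * stressSq f σ (y t) ^ 2) with ha
  have haeq : ∀ t ∈ Ioi (0 : ℝ), |-(y t * cofactor f σ c (y t))| •
      (openingDensity f σ c (y t) / 2) = a t := by
    intro t ht
    have h1 := hqpos t ht
    have h2 := hc.1.trans_le (hHy t (le_of_lt ht))
    rw [habs t ht, openingDensity, ha, smul_eq_mul]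
    field_simp
  have hDi : IntegrableOn (fun w => openingDensity f σ c w / 2) (Ioo 0 W) :=
    ((intervalIntegrable_iff_integrableOn_Ioo_of_le hW0.le).1
      (intervalIntegrable_openingDensity hf hc)).div_const 2
  have hai : IntegrableOn a (Ioi 0) := by
    rw [← himg, integrableOn_image_iff_integrableOn_abs_deriv_smul measurableSet_Ioi hyd'
      hanti.injOn] at hDi
    exact hDi.congr_fun haeq measurableSet_Ioi
  have has : 2 * ∫ t in Ioi 0, a t = opening f σ c := by
    rw [← setIntegral_congr_fun measurableSet_Ioi haeq,
      ← integral_image_eq_integral_abs_deriv_smul measurableSet_Ioi hyd' hanti.injOn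
        (fun w => openingDensity f σ c w / 2), himg, integral_div, opening,
      intervalIntegral.integral_of_le hW0.le, integral_Ioc_eq_integral_Ioo]
    ring
  obtain ⟨p, hp, hpe⟩ := exists_admissible_of_half (f := f) (u := fun t => 1 - √(y t))
    (v := fun t => √(y t) * cofactor f σ c (y t) / 2) (a := a) (S := ∅) (C := 1 / 2)
    (A := 1 / (2 * c)) (s := opening f σ c) (by fun_prop) (by fun_prop)
    (fun t ht => by
      have h1 : √(y t) ≤ 1 := Real.sqrt_le_one.2 ((hym' t ht).2.trans hW1.le)
      have h2 := cofactor_le_one (f := f) (σ := σ) c (y t)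
      have h3 := cofactor_nonneg (f := f) (σ := σ) c (y t)
      have h4 := Real.sqrt_nonneg (y t)
      rw [abs_of_nonneg (by positivity)]
      nlinarith)
    countable_empty
    (fun t ht _ => by
      have h1 := (hym t ht).1
      have h2 : 0 < √(y t) := Real.sqrt_pos.2 h1
      have h := ((hyd t ht).sqrt h1.ne').const_sub 1
      convert! h using 1
      have h3 : √(y t) * √(y t) = y t := Real.mul_self_sqrt h1.le
      field_simp
      linear_combination (cofactor f σ c (y t)) * h3)
    (fun t ht => by
      have h1 : √(y t) ≤ 1 := Real.sqrt_le_one.2 ((hym' t ht).2.trans hW1.le)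
      have h4 := Real.sqrt_nonneg (y t)
      constructor <;> linarith)
    (by
      have := (hyt.sqrt).const_sub 1
      simpa using this)
    ((measurable_const.mul hyc.measurable).div
      (measurable_const.mul ((hHc.measurable.comp hyc.measurable).pow_const 2)))
    (fun t ht => by
      have h1 := hym' t ht
      have h2 := hHy t ht
      have hc0 := hc.1
      have h3 := hc.1.trans_le h2
      simp only [ha]
      rw [abs_of_nonneg (div_nonneg (mul_nonneg hc0.le h1.1.le) (by positivity)),
        div_le_div_iff₀ (by positivity) (by positivity)]
      have h4 : y t ≤ 1 := h1.2.trans hW1.le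
      have h5 : c * c ≤ stressSq f σ (y t) ^ 2 := by nlinarith
      nlinarith [mul_nonneg (mul_nonneg hc0.le hc0.le) (sub_nonneg.2 h4)])
    hai has (opening_nonneg hf hc.1.le)
  refine ⟨p, hp, ?_⟩
  rw [hpe, ← integral_inv_cofactor hf hc, intervalIntegral.integral_of_le hW0.le,
    integral_Ioc_eq_integral_Ioo, ofReal_integral_eq_lintegral_ofReal
      ((intervalIntegrable_iff_integrableOn_Ioo_of_le hW0.le).1
        (intervalIntegrable_inv_cofactor hf hc))
      (Eventually.of_forall fun w => inv_nonneg.2 (cofactor_nonneg _ _)),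
    ← himg, lintegral_image_eq_lintegral_abs_deriv_mul measurableSet_Ioi hyd' hanti.injOn,
    ← lintegral_const_mul' _ _ (by simp)]
  -- The energy density on the half line collapses to `y/2`, while `|y'|/q = y`; the factor `2`
  -- accounts for both half lines.
  refine setLIntegral_congr_fun measurableSet_Ioi fun t ht => ?_
  have hy1 := (hym t ht).1
  have hs : 0 < √(y t) := Real.sqrt_pos.2 hy1
  have hy2 : y t ≤ 1 := (hym t ht).2.le.trans hW1.le
  have hcH := hHy t (le_of_lt ht)
  have hHeq := stressSq_eq (f := f) (σ := σ) (w := y t) ⟨hy1, hy2⟩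
  have hq := hqpos t ht
  have hH := hc.1.trans_le hcH
  have hsq : cofactor f σ c (y t) ^ 2 = 1 - (c / stressSq f σ (y t)) ^ 2 := by
    rw [cofactor_eq hcH] at hq ⊢
    exact Real.sq_sqrt (Real.sqrt_pos.1 hq).le
  have hss : √(y t) ^ 2 = y t := Real.sq_sqrt hy1.le
  have hcoef : f (1 - √(y t)) ^ 2 = stressSq f σ (y t) ^ 2 / y t := by
    rw [hHeq, mul_pow, hss]
    field_simp
  rw [coeff, if_pos (by linarith), habs t ht, ← ENNReal.ofReal_mul (sq_nonneg _),
    ← ENNReal.ofReal_add (by positivity) (by positivity),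
    ← ENNReal.ofReal_add (by positivity) (by positivity),
    ← ENNReal.ofReal_mul (mul_pos hy1 hq).le,
    show (2 : ℝ≥0∞) = ENNReal.ofReal 2 by simp, ← ENNReal.ofReal_mul (by norm_num)]
  congr 1
  have e : (√(y t) * cofactor f σ c (y t) / 2) ^ 2 =
      y t * (1 - (c / stressSq f σ (y t)) ^ 2) / 4 := by
    rw [div_pow, mul_pow, hss, hsq]
    norm_num
  rw [hcoef, sub_sub_cancel, hss, e, mul_inv_cancel_right₀ hq.ne', ha]
  field_simp
  ring

/-- A competitor whose phase field vanishes on `[-δ, δ]`, where the whole opening is located. -/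
lemma exists_plateau_pair (hf0 : f 0 = 0) {s δ : ℝ} (hs : 0 ≤ s) (hδ : 0 < δ) :
    ∃ p ∈ admissible s, energy f p = ENNReal.ofReal (1 + δ / 2) := by
  set a : ℝ → ℝ := fun t => if t ≤ δ then s / (2 * δ) else 0 with ha
  set u : ℝ → ℝ := fun t => 1 - Real.exp (-(max (t - δ) 0) / 2) with hu
  set v : ℝ → ℝ := fun t => if t ≤ δ then 0 else Real.exp (-(t - δ) / 2) / 2 with hv
  have hsplit : Ioi (0 : ℝ) = Ioc 0 δ ∪ Ioi δ := (Ioc_union_Ioi_eq_Ioi hδ.le).symm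
  have hA : 0 ≤ s / (2 * δ) := by positivity
  have ham : Measurable a := Measurable.ite measurableSet_Iic measurable_const measurable_const
  have ha1 : IntegrableOn a (Ioc 0 δ) := by
    have : IntegrableOn (fun _ : ℝ => s / (2 * δ)) (Ioc 0 δ) := by simp
    exact this.congr_fun (fun t ht => by simp [ha, ht.2]) measurableSet_Ioc
  have ha2 : IntegrableOn a (Ioi δ) :=
    (integrableOn_zero (s := Ioi δ)).congr_fun
      (fun t ht => by simp [ha, (mem_Ioi.1 ht).not_ge]) measurableSet_Ioi
  have hai : IntegrableOn a (Ioi 0) := by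
    rw [hsplit]
    exact ha1.union ha2
  have has : 2 * ∫ t in Ioi 0, a t = s := by
    rw [hsplit, setIntegral_union (Ioc_disjoint_Ioi le_rfl) measurableSet_Ioi ha1 ha2,
      setIntegral_congr_fun (g := fun _ => s / (2 * δ)) measurableSet_Ioc
        (fun t ht => by simp [ha, ht.2]),
      setIntegral_congr_fun (g := fun _ => 0) measurableSet_Ioi
        (fun t ht => by simp [ha, (mem_Ioi.1 ht).not_ge])]
    simp only [integral_const, MeasurableSet.univ, measureReal_restrict_apply, univ_inter,
      Real.volume_real_Ioc_of_le hδ.le, sub_zero, smul_eq_mul, mul_zero, add_zero]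
    field_simp
  obtain ⟨p, hp, hpe⟩ := exists_admissible_of_half (f := f) (u := u) (v := v) (a := a) (S := {δ})
    (C := 1 / 2) (A := s / (2 * δ)) (s := s) (by fun_prop)
    (Measurable.ite measurableSet_Iic measurable_const (by fun_prop))
    (fun t _ => by
      simp only [hv]
      split_ifs with h
      · simp
      · rw [abs_of_pos (by positivity)]
        have : Real.exp (-(t - δ) / 2) ≤ 1 := Real.exp_le_one_iff.2 (by linarith)
        linarith)
    (countable_singleton δ)
    (fun t _ htδ => by
      rcases lt_or_gt_of_ne (show t ≠ δ from htδ) with h | h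
      · have e : u =ᶠ[𝓝 t] fun _ => 0 := by
          filter_upwards [Iio_mem_nhds h] with x hx
          simp [hu, max_eq_right (sub_nonpos.2 (mem_Iio.1 hx).le)]
        simp only [hv, if_pos h.le]
        exact (hasDerivAt_const t (0 : ℝ)).congr_of_eventuallyEq e
      · have e : u =ᶠ[𝓝 t] fun x => 1 - Real.exp (-(x - δ) / 2) := by
          filter_upwards [Ioi_mem_nhds h] with x hx
          simp [hu, max_eq_left (sub_nonneg.2 (mem_Ioi.1 hx).le)]
        simp only [hv, if_neg h.not_ge]
        have h1 := (((hasDerivAt_id t).sub_const δ).neg.div_const 2).exp.const_sub 1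
        refine HasDerivAt.congr_of_eventuallyEq ?_ e
        convert! h1 using 1
        simp
        ring)
    (fun t _ => by
      have h1 : Real.exp (-(max (t - δ) 0) / 2) ≤ 1 :=
        Real.exp_le_one_iff.2 (by linarith [le_max_right (t - δ) 0])
      have h2 := Real.exp_pos (-(max (t - δ) 0) / 2)
      constructor <;> simp only [hu] <;> linarith)
    (by
      have h1 : Tendsto (fun t : ℝ => max (t - δ) 0 / 2) atTop atTop := by
        refine Tendsto.atTop_div_const two_pos ?_
        refine tendsto_atTop_mono (fun t => le_max_left _ _) ?_
        exact tendsto_atTop_add_const_right _ (-δ) tendsto_id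
      have h2 := (Real.tendsto_exp_neg_atTop_nhds_zero.comp h1).const_sub 1
      simp only [sub_zero] at h2
      refine h2.congr fun t => ?_
      simp [hu, neg_div])
    ham
    (fun t _ => by
      simp only [ha]
      split_ifs
      · rw [abs_of_nonneg hA]
      · simpa using hA)
    hai has hs
  refine ⟨p, hp, ?_⟩
  have e1 : ∫⁻ t in Ioc 0 δ, (coeff f (u t) * ENNReal.ofReal (a t ^ 2) +
      ENNReal.ofReal ((1 - u t) ^ 2 / 4) + ENNReal.ofReal (v t ^ 2)) =
      ENNReal.ofReal (δ / 4) := by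
    rw [setLIntegral_congr_fun (g := fun _ => ENNReal.ofReal (1 / 4)) measurableSet_Ioc]
    · rw [setLIntegral_const, Real.volume_Ioc, ← ENNReal.ofReal_mul (by norm_num)]
      congr 1
      ring
    · intro t ht
      have h1 : u t = 0 := by simp [hu, max_eq_right (sub_nonpos.2 ht.2)]
      have h2 : v t = 0 := by simp [hv, ht.2]
      simp [h1, h2, coeff, hf0]
  have e2 : ∫⁻ t in Ioi δ, (coeff f (u t) * ENNReal.ofReal (a t ^ 2) +
      ENNReal.ofReal ((1 - u t) ^ 2 / 4) + ENNReal.ofReal (v t ^ 2)) =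
      ENNReal.ofReal (1 / 2) := by
    rw [setLIntegral_congr_fun (g := fun t => ENNReal.ofReal (Real.exp δ / 2 * Real.exp (-t)))
      measurableSet_Ioi]
    · rw [← ofReal_integral_eq_lintegral_ofReal ((integrableOn_exp_neg_Ioi δ).const_mul _)
        (Eventually.of_forall fun t => by positivity), integral_const_mul, integral_exp_neg_Ioi]
      congr 1
      have : Real.exp δ * Real.exp (-δ) = 1 := by rw [← Real.exp_add]; simp
      linarith
    · intro t ht
      have h0 : ¬ t ≤ δ := not_le.2 ht
      have h1 : 1 - u t = Real.exp (-(t - δ) / 2) := by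
        simp [hu, max_eq_left (sub_nonneg.2 (le_of_lt (mem_Ioi.1 ht)))]
      have h2 : v t = Real.exp (-(t - δ) / 2) / 2 := by simp [hv, h0]
      have h3 : a t = 0 := by simp [ha, h0]
      have h4 : Real.exp (-(t - δ) / 2) ^ 2 = Real.exp δ * Real.exp (-t) := by
        rw [← Real.exp_nat_mul, ← Real.exp_add]
        congr 1
        push_cast
        ring
      simp only [h1, h2, h3]
      rw [zero_pow two_ne_zero, ENNReal.ofReal_zero, mul_zero, zero_add,
        ← ENNReal.ofReal_add (by positivity) (by positivity)]
      congr 1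
      rw [div_pow, h4]
      ring
  rw [hpe, hsplit, lintegral_union measurableSet_Ioi (Ioc_disjoint_Ioi le_rfl), e1, e2,
    ← ENNReal.ofReal_add (by positivity) (by positivity),
    show (2 : ℝ≥0∞) = ENNReal.ofReal 2 by simp, ← ENNReal.ofReal_mul (by norm_num)]
  congr 1
  ring

lemma infEnergy_le_one (hf0 : f 0 = 0) {s : ℝ} (hs : 0 ≤ s) : infEnergy f s ≤ 1 := by
  have ht : Tendsto (fun δ : ℝ => ENNReal.ofReal (1 + δ / 2)) (𝓝[>] 0) (𝓝 1) := by
    have : Tendsto (fun δ : ℝ => ENNReal.ofReal (1 + δ / 2)) (𝓝 0)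
        (𝓝 (ENNReal.ofReal (1 + 0 / 2))) :=
      (ENNReal.continuous_ofReal.comp (by fun_prop : Continuous fun δ : ℝ => 1 + δ / 2)).tendsto 0
    simp only [zero_div, add_zero, ENNReal.ofReal_one] at this
    exact this.mono_left nhdsWithin_le_nhds
  refine ge_of_tendsto ht ?_
  filter_upwards [self_mem_nhdsWithin] with δ hδ
  obtain ⟨p, hp, hpe⟩ := exists_plateau_pair hf0 hs hδ
  rw [← hpe]
  exact iInf₂_le p hp

lemma exists_pair_zero : ∃ p ∈ admissible 0, energy f p = 0 := by
  have hc : ∀ k : ℝ, MemH1Loc (fun _ => k) ∧ weakDeriv (fun _ => k) =ᵐ[volume] fun _ => (0 : ℝ) :=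
    fun k => memH1Loc_of_bounded measurable_const (C := 0) (by simp) (by simp)
  refine ⟨(fun _ => 0, fun _ => 1), ⟨(hc 0).1, (hc 1).1, ?_, ?_, by simp, tendsto_const_nhds⟩, ?_⟩
  · exact (integrable_zero ℝ ℝ volume).congr (hc 0).2.symm
  · rw [integral_congr_ae (hc 0).2]
    simp
  · rw [energy, lintegral_congr_ae (g := fun _ => 0)]
    · simp
    · filter_upwards [(hc 0).2, (hc 1).2] with t h1 h2
      simp [h1, h2]

/-! ### The value of the infimum -/

/-- The stress `σ` is optimal only for zero opening. -/
lemma minimizer_lt (hf : Assumptions f σ) {c s : ℝ} (hs : 0 < s) (hc : c ∈ Icc 0 σ)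
    (hmin : ∀ x ∈ Icc 0 σ, c * s + legendre f σ c ≤ x * s + legendre f σ x) : c < σ := by
  refine lt_of_le_of_ne hc.2 ?_
  rintro rfl
  have hσ := hf.limit_pos
  have ht : Tendsto (fun x => √(1 - (x / c) ^ 2) / c) (𝓝[<] c) (𝓝 0) := by
    have : Tendsto (fun x => √(1 - (x / c) ^ 2) / c) (𝓝 c) (𝓝 (√(1 - (c / c) ^ 2) / c)) :=
      (by fun_prop : Continuous fun x => √(1 - (x / c) ^ 2) / c).tendsto c
    rw [div_self hσ.ne'] at this
    simp only [one_pow, sub_self, Real.sqrt_zero, zero_div] at this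
    exact this.mono_left nhdsWithin_le_nhds
  refine absurd (ge_of_tendsto ht ?_) (not_le.2 hs)
  filter_upwards [Ioo_mem_nhdsLT hσ] with x hx
  have hxI : x ∈ Icc 0 c := ⟨hx.1.le, hx.2.le⟩
  have h1 := hmin x hxI
  have h2 := legendre_le hf hxI
  rw [legendre_right hf] at h1
  have h3 : (1 - x / c) * √(1 - (x / c) ^ 2) = (c - x) * (√(1 - (x / c) ^ 2) / c) := by
    field_simp
  have h4 : (c - x) * s ≤ (c - x) * (√(1 - (x / c) ^ 2) / c) := by linarith
  exact le_of_mul_le_mul_left h4 (by linarith [hx.2])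

lemma exists_energy_eq (hf : Assumptions f σ) {c s : ℝ} (hs : 0 ≤ s) (hc : c ∈ Ioc 0 σ)
    (hmin : ∀ x ∈ Icc 0 σ, c * s + legendre f σ c ≤ x * s + legendre f σ x) :
    ∃ p ∈ admissible s, energy f p = ENNReal.ofReal (c * s + legendre f σ c) := by
  rcases hs.eq_or_lt with rfl | hs
  · have h := hmin σ ⟨hf.limit_pos.le, le_rfl⟩
    rw [legendre_right hf] at h
    obtain ⟨p, hp, hpe⟩ := exists_pair_zero (f := f)
    exact ⟨p, hp, by rw [hpe, ENNReal.ofReal_eq_zero.2 (by linarith)]⟩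
  · have hlt := minimizer_lt hf hs ⟨hc.1.le, hc.2⟩ hmin
    obtain ⟨p, hp, hpe⟩ := exists_pair hf ⟨hc.1, hlt⟩
    rw [opening_eq hf ⟨hc.1, hlt⟩ hmin] at hp hpe
    exact ⟨p, hp, hpe⟩

lemma stress_mem (hf : Assumptions f σ) {b : ℝ} (hb : b ∈ Icc (0 : ℝ) 1) :
    stress f σ b ∈ Icc 0 σ := by
  rw [← stressSq_one_sub_sq hb]
  exact ⟨stressSq_nonneg hf _, stressSq_le hf _⟩

/-- For `c > 0` the value is attained. For `c = 0` it is `Φ(0) = 1`, where only the approximation by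
plateau competitors is used. The lower bound holds because each profile minimum selects an
admissible stress in the dual problem. -/
lemma infEnergy_eq (hf : Assumptions f σ) {c s : ℝ} (hs : 0 ≤ s) (hc : c ∈ Icc 0 σ)
    (hmin : ∀ x ∈ Icc 0 σ, c * s + legendre f σ c ≤ x * s + legendre f σ x) :
    infEnergy f s = ENNReal.ofReal (c * s + legendre f σ c) := by
  apply le_antisymm
  · rcases hc.1.eq_or_lt with rfl | h0
    · simpa [legendre_zero] using
        infEnergy_le_one ((hf.eq_zero_iff 0 (by simp)).2 rfl) hs
    · obtain ⟨p, hp, hpe⟩ := exists_energy_eq hf hs ⟨h0, hc.2⟩ hmin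
      rw [← hpe]
      exact iInf₂_le p hp
  · refine le_iInf₂ fun p hp => ?_
    obtain ⟨b, hb01, hb⟩ := exists_isLeast hp
    exact (ENNReal.ofReal_le_ofReal (hmin _ (stress_mem hf hb01))).trans (le_energy hf hp hb)

end CohesiveFracture

end

/-! ### The main theorem -/

open CohesiveFracture in
theorem proposition3p5 (f : ℝ → ℝ) (σ : ℝ) (hf : CohesiveFracture.Assumptions f σ) :
    (∀ s : ℝ, 0 ≤ s → CohesiveFracture.infEnergy f s ≠ ⊤) ∧
    ContDiffOn ℝ 1 (CohesiveFracture.g f) (Ici 0) ∧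
    ∃ m : ℝ → ℝ,
      (∀ s : ℝ, 0 ≤ s → CohesiveFracture.IsProfileMin f s (m s)) ∧
      m 0 = 1 ∧
      (∀ s : ℝ, 0 < s → m s ∈ Ico (0 : ℝ) 1) ∧
      (∀ s : ℝ, CohesiveFracture.sFrac f ≤ (s : EReal) → m s = 0) ∧
      HasDerivWithinAt (CohesiveFracture.g f) σ (Ici 0) 0 ∧
      ∀ s : ℝ, 0 < s →
        HasDerivAt (CohesiveFracture.g f) ((1 - m s) * f (m s)) s := by
  have hσ := hf.limit_pos
  obtain ⟨c, hcc, hcm, huniq, hmin, hder⟩ := exists_minimizer_hasDerivAt hσ.le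
    (continuous_legendre hf).continuousOn (strictConvexOn_legendre hf)
  set G : ℝ → ℝ := fun s => c s * s + legendre f σ (c s) with hG
  have hinf : ∀ s, 0 ≤ s → infEnergy f s = ENNReal.ofReal (G s) := fun s hs =>
    infEnergy_eq hf hs (hcm s) (hmin s)
  have hG0 : ∀ s, 0 ≤ s → 0 ≤ G s := fun s hs =>
    add_nonneg (mul_nonneg (hcm s).1 hs) (legendre_nonneg _)
  have hg : ∀ s, 0 ≤ s → g f s = G s := fun s hs => by
    rw [g, hinf s hs, ENNReal.toReal_ofReal (hG0 s hs)]
  have hGc : Continuous G := continuous_iff_continuousAt.2 fun s => (hder s).continuousAt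
  have hGmono : ∀ s t, s ≤ t → G s ≤ G t := fun s t hst => by
    have h1 := hmin s _ (hcm t)
    have h2 := mul_le_mul_of_nonneg_left hst (hcm t).1
    simp only [hG]
    linarith
  have h0I : (0 : ℝ) ∈ Icc 0 σ := ⟨le_rfl, hσ.le⟩
  have hGlt : ∀ s, c s ≠ 0 → G s < 1 := fun s hne => by
    by_contra h
    -- If `G s ≥ 1 = Φ(0)`, the stress `0` would also be minimal, contradicting uniqueness.
    exact hne (huniq s 0 h0I (by rw [zero_mul, legendre_zero, zero_add]; exact not_lt.1 h)).symm
  have hc0 : c 0 = σ := by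
    refine (huniq 0 σ ⟨hσ.le, le_rfl⟩ ?_).symm
    rw [legendre_right hf]
    simpa using legendre_nonneg (f := f) (σ := σ) (c 0)
  have hclt : ∀ s, 0 < s → c s < σ := fun s hs => minimizer_lt hf hs (hcm s) (hmin s)
  have hcfrac : ∀ s : ℝ, sFrac f ≤ (s : EReal) → c s = 0 := by
    intro s hs
    by_contra hne
    have h0s : 0 ≤ s := by
      have h : ((0 : ℝ) : EReal) ≤ sFrac f := by
        refine le_sSup ⟨0, ⟨le_rfl, ?_⟩, rfl⟩
        rw [hg 0 le_rfl]
        exact hGlt 0 (by rw [hc0]; exact hσ.ne')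
      exact_mod_cast h.trans hs
    -- A nonzero minimizer gives `G s < 1`, hence `G < 1` slightly to the right of `s`, beyond the
    -- supremum.
    have hev : ∀ᶠ t in 𝓝[>] s, G t < 1 :=
      nhdsWithin_le_nhds ((hGc.tendsto s).eventually (gt_mem_nhds (hGlt s hne)))
    obtain ⟨t, ht1, ht2⟩ := (hev.and self_mem_nhdsWithin).exists
    have ht2 : s < t := ht2
    have h : (t : EReal) ≤ sFrac f := by
      refine le_sSup ⟨t, ⟨by linarith, ?_⟩, rfl⟩
      rwa [hg t (by linarith)]
    exact absurd (EReal.coe_le_coe_iff.1 (h.trans hs)) (not_le.2 ht2)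
  have hw0 : width f σ 0 = 1 := by
    have := width_stressSq hf (right_mem_Icc.2 zero_le_one)
    rwa [stressSq_one hf] at this
  have hmfrac : ∀ s : ℝ, sFrac f ≤ (s : EReal) → 1 - √(width f σ (c s)) = 0 := fun s hs => by
    rw [hcfrac s hs, hw0, Real.sqrt_one, sub_self]
  refine ⟨fun s hs => by rw [hinf s hs]; exact ENNReal.ofReal_ne_top, ?_,
    fun s => 1 - √(width f σ (c s)), fun s hs => ⟨fun hlt => ⟨?_, ?_⟩, fun hle => ?_⟩, ?_, ?_,
    hmfrac, ?_, ?_⟩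
  · have hG1 : ContDiff ℝ 1 G := by
      rw [contDiff_one_iff_deriv]
      have : deriv G = c := funext fun s => (hder s).deriv
      exact ⟨fun s => (hder s).differentiableAt, this ▸ hcc⟩
    exact hG1.contDiffOn.congr hg
  · obtain ⟨_, ⟨t, ⟨ht0, htg⟩, rfl⟩, hst⟩ := lt_sSup_iff.1 hlt
    have hst' : s < t := EReal.coe_lt_coe_iff.1 hst
    rw [hg t ht0] at htg
    have hne : c s ≠ 0 := fun h => by
      have h1 := hGmono s t hst'.le
      simp only [hG, h, zero_mul, legendre_zero] at h1 htg
      linarith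
    obtain ⟨p, hp, hpe⟩ := exists_energy_eq hf hs
      ⟨lt_of_le_of_ne (hcm s).1 hne.symm, (hcm s).2⟩ (hmin s)
    exact ⟨p, hp, by rw [hpe, hinf s hs]⟩
  · rintro p ⟨hp, hpe⟩
    obtain ⟨b, hb01, hb⟩ := exists_isLeast hp
    have h := le_energy hf hp hb
    rw [hpe, hinf s hs, ENNReal.ofReal_le_ofReal_iff (hG0 s hs)] at h
    -- Optimality makes the stress at the minimum of the profile a minimizer of the dual problem, so
    -- it is `c s`; inverting the stress recovers `b`.
    have hbc := huniq s _ (stress_mem hf hb01) h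
    have hbm : 1 - √(width f σ (c s)) = b := by
      rw [← hbc, ← stressSq_one_sub_sq hb01, width_stressSq hf
        ⟨sq_nonneg _, by nlinarith [hb01.1, hb01.2]⟩, Real.sqrt_sq (by linarith [hb01.2])]
      ring
    simpa only [hbm] using hb
  · simp only [hmfrac s hle]
    refine ⟨⟨0, by simp⟩, ?_⟩
    rintro _ ⟨t, rfl⟩
    have : Real.exp (-|t| / 2) ≤ 1 := Real.exp_le_one_iff.2 (by linarith [abs_nonneg t])
    linarith
  · simp [hc0, width_eq_zero hf le_rfl]
  · intro s hs
    have hm := width_mem hf (hcm s).1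
    have h1 : √(width f σ (c s)) ≤ 1 := Real.sqrt_le_one.2 hm.2
    have h2 : 0 < √(width f σ (c s)) := Real.sqrt_pos.2 (width_pos hf (hcm s).1 (hclt s hs))
    exact ⟨by linarith, by linarith⟩
  · have h := (hder 0).hasDerivWithinAt (s := Ici 0)
    rw [hc0] at h
    exact h.congr hg (hg 0 le_rfl)
  · intro s hs
    have hm := width_mem hf (hcm s).1
    have h := stressSq_eq (f := f) (σ := σ) ⟨width_pos hf (hcm s).1 (hclt s hs), hm.2⟩
    rw [stressSq_width hf (hcm s)] at h
    simp only [sub_sub_cancel]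
    rw [← h]
    refine (hder s).congr_of_eventuallyEq ?_
    filter_upwards [Ioi_mem_nhds hs] with t ht
    exact hg t (le_of_lt ht)
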